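/- Let $p$ be a prime and let $G$ be a finite group. For a finite group $H$ let $O_p(H)$ be the largest normal $p$-subgroup of $H$; say that $H$ has characteristic $p$ if $C_H(O_p(H)) \le O_p(H)$. Assume that $G$ has parabolic characteristic $p$, that is, for every nontrivial $p$-subgroup $Q$ of $G$ such that $N_G(Q)$ contains a Sylow $p$-subgroup of $G$, the group $N_G(Q)$ has characteristic $p$. An element $x \in G$ of order $p$ is called $p$-central if it lies in the center of a Sylow $p$-subgroup of $G$. For a $p$-subgroup $P$ of $G$ let $\widehat P$ be the subgroup generated by the $p$-central elements of $G$ lying in $Z(P)$, and let $\widehat{\mathcal S}_p(G)$ be the set of nontrivial $p$-subgroups $P$ of $G$ with $\widehat P \neq 1$ (the distinguished $p$-subgroups), ordered by inclusion. Let $T$ be a subgroup of $G$ of order $p$ of noncentral type, that is, generated by an element of order $p$ which is not conjugate to any element of the center of a Sylow $p$-subgroup of $G$. Put $$\widehat{\mathcal S}_p(G)^{\le C_G(T)}_{>T} = \{P \in \widehat{\mathcal S}_p(G) \mid T < P \le C_G(T)\}, \qquad \widehat{\mathcal S}_p^{\,T}(G) = \{Q \in \widehat{\mathcal S}_p(G)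 \mid T \le N_G(Q)\}.$$ The group $N_G(T)$ acts on both posets by conjugation, hence on the geometric realizations of their order complexes (the simplicial complexes whose simplices are the nonempty finite chains). Then $\widehat{\mathcal S}_p(G)^{\le C_G(T)}_{>T} \subseteq \widehat{\mathcal S}_p^{\,T}(G)$, and the map of geometric realizations induced by this inclusion is an $N_G(T)$-homotopy equivalence: it is $N_G(T)$-equivariant, and there is an $N_G(T)$-equivariant continuous map in the opposite direction such that both composites are homotopic to the identity maps through $N_G(T)$-equivariant maps. -/

import Mathlib

/-! ### Group theory -/

section GroupTheory

variable (p : ℕ) {G : Type*} [Group G]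

/-- `O_p(G)`, the join of all normal `p`-subgroups of `G`. For a finite group this is the largest
normal `p`-subgroup. -/
def opCore (p : ℕ) (G : Type*) [Group G] : Subgroup G :=
  sSup {N : Subgroup G | N.Normal ∧ IsPGroup p N}

/-- `G` has characteristic `p` if `C_G(O_p(G)) ≤ O_p(G)`. -/
def HasCharacteristic (p : ℕ) (G : Type*) [Group G] : Prop :=
  Subgroup.centralizer (opCore p G : Set G) ≤ opCore p G

/-- A `p`-local subgroup is the normalizer of a nontrivial `p`-subgroup. -/
def IsPLocal (H : Subgroup G) : Prop :=
  ∃ Q : Subgroup G, IsPGroup p Q ∧ Q ≠ ⊥ ∧ H = Subgroup.normalizer (Q : Set G)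

/-- A parabolic subgroup is one which contains a Sylow `p`-subgroup. -/
def IsParabolic (H : Subgroup G) : Prop :=
  ∃ S : Sylow p G, (S : Subgroup G) ≤ H

/-- `G` has parabolic characteristic `p` if all its `p`-local parabolic subgroups have
characteristic `p`. -/
def HasParabolicCharacteristic (p : ℕ) (G : Type*) [Group G] : Prop :=
  ∀ H : Subgroup G, IsPLocal p H → IsParabolic p H → HasCharacteristic p H

/-- The center `Z(P)` of a subgroup `P ≤ G`, as a subgroup of `G`. -/
def centerIn (P : Subgroup G) : Subgroup G := (Subgroup.center P).map P.subtype

/-- An element of order `p` is `p`-central if it lies in the center of a Sylow `p`-subgroup. -/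
def IsPCentral (x : G) : Prop :=
  orderOf x = p ∧ ∃ S : Sylow p G, x ∈ centerIn (S : Subgroup G)

/-- `P̂ = ⟨x ∣ x ∈ Ω₁ Z(P) ∩ Γ_p(G)⟩`, with `Ω₁ Z(P) = {x ∈ Z(P) ∣ x ^ p = 1}` and `Γ_p(G)` the
set of `p`-central elements of `G`. -/
def hatSubgroup (P : Subgroup G) : Subgroup G :=
  Subgroup.closure {x : G | (x ∈ centerIn P ∧ x ^ p = 1) ∧ IsPCentral p x}

/-- `Ŝ_p(G)`: the nontrivial `p`-subgroups `P` of `G` with `P̂ ≠ 1`. -/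
def distinguishedSubgroups (p : ℕ) (G : Type*) [Group G] : Set (Subgroup G) :=
  {P | (IsPGroup p P ∧ P ≠ ⊥) ∧ hatSubgroup p P ≠ ⊥}

/-- `T` is a subgroup of order `p` of noncentral type: it is generated by an element of order `p`
which is not conjugate to any element of the center of a Sylow `p`-subgroup. -/
def IsNoncentralOfOrder (T : Subgroup G) : Prop :=
  ∃ x : G, orderOf x = p ∧
    (∀ S : Sylow p G, ∀ z ∈ centerIn (S : Subgroup G), ¬ IsConj x z) ∧ T = Subgroup.zpowers x

end GroupTheory

/-! ### The conjugation action of a subgroup `H` on the set of subgroups of `G` -/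

section Conjugation

variable {p : ℕ} {G : Type*} [Group G]

/-- A subgroup `H ≤ G` acts on the poset of subgroups of `G` by `h • P = h P h⁻¹`. -/
instance conjSubgroupAction (H : Subgroup G) : MulAction H (Subgroup G) where
  smul h P := P.map (MulAut.conj (h : G)).toMonoidHom
  one_smul P := by
    ext x
    change x ∈ P.map (MulAut.conj ((1 : H) : G)).toMonoidHom ↔ x ∈ P
    simp [Subgroup.mem_map]
  mul_smul g h P := by
    ext x
    change x ∈ P.map (MulAut.conj ((g * h : H) : G)).toMonoidHom ↔
      x ∈ (P.map (MulAut.conj (h : G)).toMonoidHom).map (MulAut.conj (g : G)).toMonoidHom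
    simp [Subgroup.mem_map, mul_assoc]

theorem conj_smul_def (H : Subgroup G) (h : H) (P : Subgroup G) :
    h • P = P.map (MulAut.conj (h : G)).toMonoidHom := rfl

theorem mem_conj_smul (H : Subgroup G) (h : H) (P : Subgroup G) (x : G) :
    x ∈ h • P ↔ (h : G)⁻¹ * x * h ∈ P := by
  rw [conj_smul_def, Subgroup.mem_map]
  constructor
  · rintro ⟨y, hy, rfl⟩
    simpa [mul_assoc] using hy
  · intro hx
    exact ⟨_, hx, by simp [mul_assoc]⟩

theorem mem_centerIn {P : Subgroup G} {x : G} :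
    x ∈ centerIn P ↔ x ∈ P ∧ ∀ y ∈ P, y * x = x * y := by
  simp only [centerIn, Subgroup.mem_map, Subgroup.mem_center_iff]
  constructor
  · rintro ⟨x, hx, rfl⟩
    exact ⟨x.2, fun y hy => congrArg Subtype.val (hx ⟨y, hy⟩)⟩
  · rintro ⟨hx, h⟩
    exact ⟨⟨x, hx⟩, fun y => Subtype.ext (h y y.2), rfl⟩

theorem conj_mem_centerIn {P Q : Subgroup G} (g : G)
    (hQ : ∀ y, y ∈ Q ↔ g⁻¹ * y * g ∈ P) {x : G} (hx : x ∈ centerIn P) :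
    g * x * g⁻¹ ∈ centerIn Q := by
  rw [mem_centerIn] at hx ⊢
  refine ⟨(hQ _).2 (by simpa [mul_assoc] using hx.1), fun y hy => ?_⟩
  have h := hx.2 _ ((hQ y).1 hy)
  calc y * (g * x * g⁻¹) = g * (g⁻¹ * y * g * x) * g⁻¹ := by group
    _ = g * (x * (g⁻¹ * y * g)) * g⁻¹ := by rw [h]
    _ = g * x * g⁻¹ * y := by group

theorem isPCentral_conj {x : G} (g : G) (hx : IsPCentral p x) :
    IsPCentral p (g * x * g⁻¹) := by
  obtain ⟨ho, S, hS⟩ := hx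
  refine ⟨?_, g • S, conj_mem_centerIn g (fun y => ?_) hS⟩
  · rw [← ho]
    exact orderOf_injective (MulAut.conj g).toMonoidHom (MulAut.conj g).injective x
  · change y ∈ g • S ↔ _
    rw [← SetLike.mem_coe, Sylow.coe_smul]
    simp [Set.mem_smul_set_iff_inv_smul_mem, ← map_inv]
    exact Iff.rfl

theorem conj_smul_ne_bot (H : Subgroup G) (h : H) {P : Subgroup G} (hP : P ≠ ⊥) :
    h • P ≠ ⊥ := by
  rw [conj_smul_def]
  exact fun e => hP ((Subgroup.map_eq_bot_iff_of_injective P (MulAut.conj (h : G)).injective).1 e)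

/-- The distinguished `p`-subgroups are closed under conjugation. -/
theorem conj_smul_mem_distinguished (H : Subgroup G) (h : H) {P : Subgroup G}
    (hP : P ∈ distinguishedSubgroups p G) : h • P ∈ distinguishedSubgroups p G := by
  obtain ⟨⟨h1, h2⟩, h3⟩ := hP
  refine ⟨⟨h1.map _, conj_smul_ne_bot H h h2⟩, fun e => h3 ?_⟩
  unfold hatSubgroup at e ⊢
  rw [Subgroup.closure_eq_bot_iff] at e ⊢
  rintro x ⟨⟨hx, hxp⟩, hc⟩
  have : (h : G) * x * (h : G)⁻¹ ∈ ({1} : Set G) :=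
    e ⟨⟨conj_mem_centerIn (h : G) (mem_conj_smul H h P) hx, by simp [conj_pow, hxp]⟩,
      isPCentral_conj (h : G) hc⟩
  simpa using this

/-- A normalizing element fixes `T` under conjugation. -/
theorem conj_smul_eq_self (T : Subgroup G) (h : Subgroup.normalizer (T : Set G)) : h • T = T := by
  ext x
  rw [mem_conj_smul]
  have := (Subgroup.mem_normalizer_iff.1 ((Subgroup.normalizer (T : Set G)).inv_mem h.2)) x
  simpa using this.symm

theorem conj_smul_mono (H : Subgroup G) (h : H) {P Q : Subgroup G} (hPQ : P ≤ Q) :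
    h • P ≤ h • Q := Subgroup.map_mono hPQ

/-- `Ŝ_p(G)_{>T}^{≤C_G(T)}`: the distinguished `p`-subgroups `P` with `T < P ≤ C_G(T)`, as a set of
subgroups of `G` stable under conjugation by `N_G(T)`. -/
def distinguishedAbove (p : ℕ) (T : Subgroup G) :
    SubMulAction (Subgroup.normalizer (T : Set G)) (Subgroup G) where
  carrier := {P | P ∈ distinguishedSubgroups p G ∧ T < P ∧ P ≤ Subgroup.centralizer (T : Set G)}
  smul_mem' := by
    rintro h P ⟨h1, h2, h3⟩
    refine ⟨conj_smul_mem_distinguished _ h h1, lt_of_le_of_ne ?_ ?_, ?_⟩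
    · conv_lhs => rw [← conj_smul_eq_self T h]
      exact conj_smul_mono _ h h2.le
    · intro e
      exact h2.ne (MulAction.injective h ((conj_smul_eq_self T h).trans e))
    · intro x hx
      rw [mem_conj_smul] at hx
      have hx := Subgroup.mem_centralizer_iff.1 (h3 hx)
      refine Subgroup.mem_centralizer_iff.2 fun t ht => ?_
      have ht' : (h : G)⁻¹ * t * h ∈ T := by
        rw [← mem_conj_smul _ h, conj_smul_eq_self]; exact ht
      have := hx _ ht'
      calc t * x = h * ((h : G)⁻¹ * t * h * ((h : G)⁻¹ * x * h)) * (h : G)⁻¹ := by group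
        _ = h * ((h : G)⁻¹ * x * h * ((h : G)⁻¹ * t * h)) * (h : G)⁻¹ := by rw [this]
        _ = x * t := by group

/-- `Ŝ_p^T(G)`: the distinguished `p`-subgroups `Q` fixed under conjugation by `T`, that is with
`T ≤ N_G(Q)`, as a set of subgroups of `G` stable under conjugation by `N_G(T)`. -/
def distinguishedFixed (p : ℕ) (T : Subgroup G) :
    SubMulAction (Subgroup.normalizer (T : Set G)) (Subgroup G) where
  carrier := {Q | Q ∈ distinguishedSubgroups p G ∧ T ≤ Subgroup.normalizer (Q : Set G)}
  smul_mem' := by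
    rintro h Q ⟨h1, h2⟩
    refine ⟨conj_smul_mem_distinguished _ h h1, fun t ht => ?_⟩
    have ht' : (h : G)⁻¹ * t * h ∈ T := by
      rw [← mem_conj_smul _ h, conj_smul_eq_self]; exact ht
    have hn := Subgroup.mem_normalizer_iff.1 (h2 ht')
    refine Subgroup.mem_normalizer_iff.2 fun x => ?_
    have := hn ((h : G)⁻¹ * x * h)
    change x ∈ h • Q ↔ t * x * t⁻¹ ∈ h • Q
    rw [mem_conj_smul, mem_conj_smul]
    have e : (h : G)⁻¹ * t * h * ((h : G)⁻¹ * x * h) * ((h : G)⁻¹ * t * h)⁻¹ =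
        (h : G)⁻¹ * (t * x * t⁻¹) * h := by group
    rw [e] at this
    exact this

theorem distinguishedAbove_le_fixed (p : ℕ) (T : Subgroup G) :
    distinguishedAbove p T ≤ distinguishedFixed p T := by
  rintro P ⟨h1, h2, -⟩
  exact ⟨h1, h2.le.trans Subgroup.le_normalizer⟩

/-- The inclusion of posets `Ŝ_p(G)_{>T}^{≤C_G(T)} ↪ Ŝ_p^T(G)`. -/
def distinguishedInclusion (p : ℕ) (T : Subgroup G) :
    distinguishedAbove p T →o distinguishedFixed p T where
  toFun P := ⟨P, distinguishedAbove_le_fixed p T P.2⟩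
  monotone' _ _ h := h

/-- Conjugation preserves inclusions. -/
instance conjCovariant (H : Subgroup G) (X : SubMulAction H (Subgroup G)) :
    CovariantClass H X (· • ·) (· ≤ ·) where
  elim h _ _ hPQ := conj_smul_mono H h hPQ

end Conjugation

/-! ### Realization of a finite poset, and equivariant homotopy equivalences -/

section Topology

/-- The geometric realization `|P|` of the order complex of a finite poset `P` (whose simplices are
the nonempty finite chains of `P`), in barycentric coordinates: families of nonnegative reals with
sum `1` whose support is a chain. -/
@[ext]
structure PosetRealization (P : Type*) [PartialOrder P] [Finite P] where
  coord : P → ℝ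
  nonneg : ∀ a, 0 ≤ coord a
  sum_eq_one : ∑ᶠ a, coord a = 1
  isChain_support : IsChain (· ≤ ·) (Function.support coord)

/-- The topology of `|P|` is induced from the finite-dimensional space `ℝ^P`. -/
instance (P : Type*) [PartialOrder P] [Finite P] : TopologicalSpace (PosetRealization P) :=
  TopologicalSpace.induced PosetRealization.coord inferInstance

/-- A group acting on `P` by poset automorphisms acts on `|P|`, simplicially: the coordinate of
`h • x` at `h • a` is the coordinate of `x` at `a`. -/
instance {H P : Type*} [Group H] [PartialOrder P] [Finite P] [MulAction H P]
    [CovariantClass H P (· • ·) (· ≤ ·)] : MulAction H (PosetRealization P) where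
  smul h x :=
    { coord := fun a => x.coord (h⁻¹ • a)
      nonneg := fun a => x.nonneg _
      sum_eq_one := (finsum_comp_equiv (MulAction.toPerm h⁻¹) (f := x.coord)).trans x.sum_eq_one
      isChain_support := by
        intro a ha b hb _
        have hle : ∀ {c d : P}, h⁻¹ • c ≤ h⁻¹ • d → c ≤ d := fun {c d} hcd => by
          simpa using (CovariantClass.elim h hcd : h • h⁻¹ • c ≤ h • h⁻¹ • d)
        rcases x.isChain_support.total ha hb with hab | hab
        · exact Or.inl (hle hab)
        · exact Or.inr (hle hab) }
  one_smul x := PosetRealization.ext (funext fun a => by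
    change x.coord ((1 : H)⁻¹ • a) = x.coord a
    simp)
  mul_smul g h x := PosetRealization.ext (funext fun a => by
    change x.coord ((g * h)⁻¹ • a) = x.coord (h⁻¹ • g⁻¹ • a)
    rw [mul_inv_rev, mul_smul])

/-- The continuous map `|f| : |P| → |Q|` induced by a poset map `f`, affine on each simplex: the
coordinate at `b` is the sum of the coordinates at all `a` with `f a = b`. -/
noncomputable def PosetRealization.map {P Q : Type*} [PartialOrder P] [Finite P] [PartialOrder Q]
    [Finite Q] (f : P →o Q) : C(PosetRealization P, PosetRealization Q) where
  toFun x :=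
    { coord := fun b => ∑ᶠ (a : P) (_ : f a = b), x.coord a
      nonneg := fun b => finsum_nonneg fun a => finsum_nonneg fun _ => x.nonneg a
      sum_eq_one := by
        classical
        have := Fintype.ofFinite P
        have := Fintype.ofFinite Q
        rw [← x.sum_eq_one]
        simp only [finsum_eq_sum_of_fintype, finsum_eq_if]
        rw [Finset.sum_comm]
        simp
      isChain_support := by
        have key : ∀ b, (∑ᶠ (a : P) (_ : f a = b), x.coord a) ≠ 0 →
            ∃ a, f a = b ∧ x.coord a ≠ 0 := by
          intro b hb
          by_contra! hcon
          refine hb (finsum_eq_zero_of_forall_eq_zero fun a => ?_)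
          by_cases h : f a = b
          · simpa [h] using hcon a h
          · simp [h]
        intro b hb c hc _
        obtain ⟨a, rfl, ha⟩ := key b hb
        obtain ⟨d, rfl, hd⟩ := key c hc
        rcases x.isChain_support.total ha hd with h | h
        · exact Or.inl (f.monotone h)
        · exact Or.inr (f.monotone h) }
  continuous_toFun := by
    classical
    have := Fintype.ofFinite P
    refine continuous_induced_rng.2 (continuous_pi fun b => ?_)
    simp only [Function.comp_def, finsum_eq_sum_of_fintype, finsum_eq_if]
    refine continuous_finsetSum _ fun a _ => ?_
    split_ifs
    · exact (continuous_apply a).comp continuous_induced_dom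
    · exact continuous_const

/-- `f : X → Y` is an `H`-homotopy equivalence: it is `H`-equivariant, and there is an
`H`-equivariant map `g : Y → X` such that `g ∘ f` and `f ∘ g` are homotopic to the identities through
`H`-equivariant maps. -/
def IsEquivariantHomotopyEquiv (H : Type*) [Group H] {X Y : Type*} [TopologicalSpace X]
    [TopologicalSpace Y] [MulAction H X] [MulAction H Y] (f : C(X, Y)) : Prop :=
  (∀ (h : H) (x : X), f (h • x) = h • f x) ∧
  ∃ g : C(Y, X), (∀ (h : H) (y : Y), g (h • y) = h • g y) ∧
    (∃ F : (g.comp f).Homotopy (ContinuousMap.id X),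
      ∀ (h : H) (t : unitInterval) (x : X), F (t, h • x) = h • F (t, x)) ∧
    (∃ F : (f.comp g).Homotopy (ContinuousMap.id Y),
      ∀ (h : H) (t : unitInterval) (y : Y), F (t, h • y) = h • F (t, y))

end Topology

/-! ### Homotopy equivalences -/

section Homotopy

open unitInterval

variable {H X Y Z : Type*} [Group H] [TopologicalSpace X] [TopologicalSpace Y] [TopologicalSpace Z]
  [MulAction H X] [MulAction H Y] [MulAction H Z]

/-! The inclusion is factored through the poset of distinguished `p`-subgroups containing `T`.

The lower inclusion has the retraction `Q ↦ C_Q(T)`. If `T ≤ Q` then `Z(Q) ≤ C_Q(T)`, so `C_Q(T)`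
inherits a `p`-central element in its center; it is strictly larger than `T` because `T`, being of
noncentral type, is not distinguished. The retraction lies below the identity, and comparable poset
maps are homotopic (`slide`).

For the upper inclusion the subgroups `Q` that do not contain `T` are removed, minimal ones first.
This is harmless because the `T`-invariant distinguished `R > Q` form a contractible poset, by the
zigzag `R ≥ N_R(Q) ≤ N_R(Q) T O_p(N_G(Q)) ≥ T O_p(N_G(Q))`. The groups on the right must be
distinguished. This follows from `centralizer_subgroupCore_le`: for distinguished `Q` the group
`N_G(Q)` has characteristic `p`. Hence if a `p`-subgroup `U` contains `O_p(N_G(Q))` and `S` is a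
Sylow subgroup over `U`, then `Z(S)` centralizes `O_p(N_G(Q))`, so it lies in `U` and therefore in
`Z(U)`. The characteristic `p` property itself is carried from `N_G(⟨z⟩)`, with `z` a `p`-central
element of `Z(Q)`, to `N_G(Q)` by Thompson's `A × B` lemma.

On the topological side, removing minimal elements removes open cones over their upper links. All
the maps in the zigzag are natural in `Q`, so the links contract simultaneously and equivariantly,
and `isEquivariantHomotopyEquiv_of_cone` turns this into explicit equivariant homotopies. -/

theorem IsEquivariantHomotopyEquiv.trans {f : C(X, Y)} {f' : C(Y, Z)}
    (hf : IsEquivariantHomotopyEquiv H f) (hf' : IsEquivariantHomotopyEquiv H f') :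
    IsEquivariantHomotopyEquiv H (f'.comp f) := by
  obtain ⟨ef, g, eg, ⟨F, eF⟩, F', eF'⟩ := hf
  obtain ⟨ef1, g1, eg1, ⟨F1, eF1⟩, F1', eF1'⟩ := hf'
  let A : ((g.comp g1).comp (f'.comp f)).Homotopy (g.comp f) :=
    { toFun := fun p => g (F1 (p.1, f p.2))
      continuous_toFun := by fun_prop
      map_zero_left := by simp
      map_one_left := by simp }
  let B : ((f'.comp f).comp (g.comp g1)).Homotopy (f'.comp g1) :=
    { toFun := fun p => f' (F' (p.1, g1 p.2))
      continuous_toFun := by fun_prop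
      map_zero_left := by simp
      map_one_left := by simp }
  refine ⟨fun h x => by simp [ef, ef1], g.comp g1, fun h x => by simp [eg, eg1],
    ⟨A.trans F, fun h t x => ?_⟩, B.trans F1', fun h t x => ?_⟩
  · rw [ContinuousMap.Homotopy.trans_apply, ContinuousMap.Homotopy.trans_apply]
    split_ifs
    · change g (F1 (_, f (h • x))) = h • g (F1 (_, f x))
      rw [ef, eF1, eg]
    · exact eF _ _ _
  · rw [ContinuousMap.Homotopy.trans_apply, ContinuousMap.Homotopy.trans_apply]
    split_ifs
    · change f' (F' (_, g1 (h • x))) = h • f' (F' (_, g1 x))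
      rw [eg1, eF', ef1]
    · exact eF1' _ _ _

theorem IsEquivariantHomotopyEquiv.refl :
    IsEquivariantHomotopyEquiv H (ContinuousMap.id X) :=
  ⟨fun _ _ => rfl, ContinuousMap.id X, fun _ _ => rfl,
    ⟨ContinuousMap.Homotopy.refl _, fun _ _ _ => rfl⟩,
    ContinuousMap.Homotopy.refl _, fun _ _ _ => rfl⟩

/-- Reduces properties that hold at every single time, such as equivariance or preservation of
fibres, from a concatenated homotopy to its pieces. -/
theorem ContinuousMap.Homotopy.trans_apply_eq_or {f₀ f₁ f₂ : C(X, Y)} (F : f₀.Homotopy f₁)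
    (F' : f₁.Homotopy f₂) (t : I) :
    ∃ t', (∀ x, F.trans F' (t, x) = F (t', x)) ∨ ∀ x, F.trans F' (t, x) = F' (t', x) := by
  by_cases ht : (t : ℝ) ≤ 1 / 2
  · refine ⟨⟨2 * t, (unitInterval.mul_pos_mem_iff zero_lt_two).2 ⟨t.2.1, ht⟩⟩, Or.inl fun x => ?_⟩
    rw [F.trans_apply F']
    exact dif_pos ht
  · refine ⟨⟨2 * t - 1, unitInterval.two_mul_sub_one_mem_iff.2 ⟨(not_le.1 ht).le, t.2.2⟩⟩,
      Or.inr fun x => ?_⟩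
    rw [F.trans_apply F']
    exact dif_neg ht

/-- Attaching cones to a space `L` along the fibres of a map `π : Z → L`: if `Z` contracts
fibrewise, the inclusion of `L` into the resulting space `K` is an equivariant homotopy
equivalence. Here `c (z, s)` is the point at height `s` above `z`. -/
theorem isEquivariantHomotopyEquiv_of_cone {L K : Type*} [TopologicalSpace L] [TopologicalSpace K]
    [MulAction H L] [MulAction H K] [CompactSpace L] [CompactSpace Z] [T2Space K]
    (i : C(L, K)) (π : C(Z, L)) (c : C(Z × I, K)) {γ : C(Z, Z)}
    (Γ : (ContinuousMap.id Z).Homotopy γ)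
    (hi : ∀ (h : H) x, i (h • x) = h • i x)
    (hc : ∀ (h : H) z s, c (h • z, s) = h • c (z, s))
    (hΓ : ∀ (h : H) t z, Γ (t, h • z) = h • Γ (t, z))
    (inj : Function.Injective i) (c_zero : ∀ z, c (z, 0) = i (π z))
    (c_eq_i : ∀ z s l, c (z, s) = i l → s = 0)
    (c_eq_c : ∀ z s z' s', c (z, s) = c (z', s') → s = s' ∧ (s = 0 ∨ s = 1 ∨ z = z'))
    (c_one : ∀ z z', c (z, 1) = c (z', 1) → γ z = γ z')
    (Γ_fib : ∀ t z, c (Γ (t, z), 1) = c (z, 1))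
    (surj : ∀ x, (∃ l, i l = x) ∨ ∃ z s, c (z, s) = x) :
    IsEquivariantHomotopyEquiv H i := by
  have eπ : ∀ (h : H) z, π (h • z) = h • π z := fun h z => inj (by
    rw [hi, ← c_zero, ← c_zero, hc])
  -- the retraction
  let Θ : C(L ⊕ Z × I, K) := ⟨Sum.elim i c, i.continuous.sumElim c.continuous⟩
  have sΘ : Function.Surjective Θ := fun x => by
    rcases surj x with ⟨l, h⟩ | ⟨z, s, h⟩
    · exact ⟨Sum.inl l, h⟩
    · exact ⟨Sum.inr (z, s), h⟩
  -- A continuous map from a compact space to a Hausdorff space is closed, so maps out of `K` may be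
  -- defined on the base and on the cones separately.
  have qΘ : Topology.IsQuotientMap Θ := Θ.continuous.isClosedMap.isQuotientMap Θ.continuous sΘ
  -- The height serves as the time of the contraction: at height 0 this is `π`, and at height 1 it
  -- depends only on the apex.
  let R : C(L ⊕ Z × I, L) :=
    ⟨Sum.elim id fun p => π (Γ (p.2, p.1)), continuous_id.sumElim (by fun_prop)⟩
  have key1 : ∀ z s l, c (z, s) = i l → π (Γ (s, z)) = l := fun z s l e => by
    obtain rfl := c_eq_i _ _ _ e
    rw [Γ.apply_zero]
    exact inj (by rw [← e, c_zero]; rfl)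
  have key2 : ∀ z s z' s', c (z, s) = c (z', s') → π (Γ (s, z)) = π (Γ (s', z')) := by
    intro z s z' s' e
    obtain ⟨rfl, rfl | rfl | rfl⟩ := c_eq_c _ _ _ _ e
    · exact key1 _ _ _ (e.trans ((c_zero _).trans (by rw [Γ.apply_zero]; rfl)))
    · rw [Γ.apply_one, Γ.apply_one, c_one _ _ e]
    · rfl
  have hR : ∀ a b, Θ a = Θ b → R a = R b := by
    rintro (l | ⟨z, s⟩) (l' | ⟨z', s'⟩) e
    · exact inj e
    · exact (key1 _ _ _ e.symm).symm
    · exact key1 _ _ _ e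
    · exact key2 _ _ _ _ e
  let r : C(K, L) := qΘ.lift R hR
  have r_i : ∀ l, r (i l) = l := fun l =>
    congrArg (fun f : C(L ⊕ Z × I, L) => f (Sum.inl l)) (qΘ.lift_comp R hR)
  have r_c : ∀ z s, r (c (z, s)) = π (Γ (s, z)) := fun z s =>
    congrArg (fun f : C(L ⊕ Z × I, L) => f (Sum.inr (z, s))) (qΘ.lift_comp R hR)
  -- the homotopy
  let a : I → I := fun t => Set.projIcc 0 1 zero_le_one (2 * (t : ℝ))
  let b : I → I := fun t => Set.projIcc 0 1 zero_le_one (2 - 2 * (t : ℝ))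
  have ca : Continuous a := continuous_projIcc.comp (by fun_prop)
  have cb : Continuous b := continuous_projIcc.comp (by fun_prop)
  have a0 : a 0 = 0 := by simp [a, Set.projIcc_of_le_left]
  have a1 : a 1 = 1 := Set.projIcc_of_right_le _ (by norm_num)
  have b0 : b 0 = 1 := Set.projIcc_of_right_le _ (by norm_num)
  have b1 : b 1 = 0 := Set.projIcc_of_le_left _ (by norm_num)
  -- First `a` rises from 0 to 1 while `b` stays at 1, then `b` falls to 0. Never having both below
  -- 1 makes the homotopy well defined at an apex: `a t = 1` keeps the apex fixed, and `b t = 1`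
  -- means that the fibre has already been contracted.
  have ab : ∀ t, a t = 1 ∨ b t = 1 := fun t => by
    rcases le_total (1 : ℝ) (2 * t) with h | h
    · exact Or.inl (Set.projIcc_of_right_le _ h)
    · exact Or.inr (Set.projIcc_of_right_le _ (by linarith))
  let Ψ : C(I × L ⊕ I × (Z × I), I × K) :=
    ⟨Sum.elim (fun p => (p.1, i p.2)) (fun p => (p.1, c p.2)),
      Continuous.sumElim (by fun_prop) (by fun_prop)⟩
  have sΨ : Function.Surjective Ψ := fun ⟨t, x⟩ => by
    rcases surj x with ⟨l, h⟩ | ⟨z, s, h⟩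
    · exact ⟨Sum.inl (t, l), Prod.ext rfl h⟩
    · exact ⟨Sum.inr (t, z, s), Prod.ext rfl h⟩
  have qΨ : Topology.IsQuotientMap Ψ := Ψ.continuous.isClosedMap.isQuotientMap Ψ.continuous sΨ
  -- At `t = 0` the height is 0 and the contraction has run for time `s`, which is the retraction;
  -- at `t = 1` this is the identity.
  let D : C(I × L ⊕ I × (Z × I), K) :=
    ⟨Sum.elim (fun p => i p.2)
      (fun p => c (Γ (p.2.2 * b p.1, p.2.1), p.2.2 * a p.1)),
      Continuous.sumElim (by fun_prop) (by fun_prop)⟩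
  have key3 : ∀ t z s l, c (z, s) = i l → c (Γ (s * b t, z), s * a t) = i l := by
    intro t z s l e
    obtain rfl := c_eq_i _ _ _ e
    rw [zero_mul, zero_mul, Γ.apply_zero]
    exact e
  have hD : ∀ x y, Ψ x = Ψ y → D x = D y := by
    rintro (⟨t, l⟩ | ⟨t, z, s⟩) (⟨t', l'⟩ | ⟨t', z', s'⟩) e
    · exact congrArg Prod.snd e
    · exact (key3 t' z' s' l (congrArg Prod.snd e).symm).symm
    · exact key3 t z s l' (congrArg Prod.snd e)
    · obtain rfl : t = t' := congrArg Prod.fst e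
      replace e : c (z, s) = c (z', s') := congrArg Prod.snd e
      change c (Γ (s * b t, z), s * a t) = c (Γ (s' * b t, z'), s' * a t)
      obtain ⟨rfl, rfl | rfl | rfl⟩ := c_eq_c _ _ _ _ e
      · rw [key3 t z 0 _ ((c_zero z)), key3 t z' 0 _ (c_zero z'), ← c_zero, ← c_zero, e]
      · rcases ab t with h | h
        · rw [h, one_mul, mul_one, Γ_fib, Γ_fib, e]
        · rw [h, one_mul, Γ.apply_one, Γ.apply_one, c_one _ _ e]
      · rfl
  let F : C(I × K, K) := qΨ.lift D hD
  have F_i : ∀ t l, F (t, i l) = i l := fun t l =>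
    congrArg (fun f : C(I × L ⊕ I × (Z × I), K) => f (Sum.inl (t, l))) (qΨ.lift_comp D hD)
  have F_c : ∀ t z s, F (t, c (z, s)) = c (Γ (s * b t, z), s * a t) := fun t z s =>
    congrArg (fun f : C(I × L ⊕ I × (Z × I), K) => f (Sum.inr (t, z, s))) (qΨ.lift_comp D hD)
  refine ⟨hi, r, fun h x => ?_, ?_, ⟨⟨F, fun x => ?_, fun x => ?_⟩, fun h t x => ?_⟩⟩
  · rcases surj x with ⟨l, rfl⟩ | ⟨z, s, rfl⟩
    · rw [← hi, r_i, r_i]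
    · rw [← hc, r_c, r_c, hΓ, eπ]
  · have e : r.comp i = ContinuousMap.id L := ContinuousMap.ext r_i
    rw [e]
    exact ⟨ContinuousMap.Homotopy.refl _, fun _ _ _ => rfl⟩
  · change F (0, x) = i (r x)
    rcases surj x with ⟨l, rfl⟩ | ⟨z, s, rfl⟩
    · rw [F_i, r_i]
    · rw [F_c, r_c, a0, b0, mul_one, mul_zero, c_zero]
  · change F (1, x) = x
    rcases surj x with ⟨l, rfl⟩ | ⟨z, s, rfl⟩
    · rw [F_i]
    · rw [F_c, a1, b1, mul_one, mul_zero, Γ.apply_zero]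
      rfl
  · change F (t, h • x) = h • F (t, x)
    rcases surj x with ⟨l, rfl⟩ | ⟨z, s, rfl⟩
    · rw [← hi, F_i, F_i, hi]
    · rw [← hc, F_c, F_c, hΓ, hc]

end Homotopy

/-! ### Realizations of finite posets -/

section Pushforward

variable {ι κ : Type*}

/-- The pushforward of a weight function on a finite type. -/
noncomputable def pushWeight (f : ι → κ) (w : ι → ℝ) (b : κ) : ℝ :=
  ∑ᶠ (i : ι) (_ : f i = b), w i

theorem pushWeight_eq_sum [Fintype ι] [DecidableEq κ] (f : ι → κ) (w : ι → ℝ) (b : κ) :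
    pushWeight f w b = ∑ i, if f i = b then w i else 0 := by
  classical
  simp only [pushWeight, finsum_eq_sum_of_fintype, finsum_eq_if]

theorem pushWeight_nonneg (f : ι → κ) {w : ι → ℝ} (hw : ∀ i, 0 ≤ w i) (b : κ) :
    0 ≤ pushWeight f w b :=
  finsum_nonneg fun i => finsum_nonneg fun _ => hw i

theorem exists_of_pushWeight_ne_zero [Finite ι] {f : ι → κ} {w : ι → ℝ} {b : κ}
    (h : pushWeight f w b ≠ 0) : ∃ i, f i = b ∧ w i ≠ 0 := by
  classical
  have := Fintype.ofFinite ι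
  rw [pushWeight_eq_sum] at h
  obtain ⟨i, -, hi⟩ := Finset.exists_ne_zero_of_sum_ne_zero h
  by_cases e : f i = b
  · exact ⟨i, e, by simpa [e] using hi⟩
  · simp [e] at hi

theorem finsum_pushWeight [Finite ι] [Finite κ] (f : ι → κ) (w : ι → ℝ) : ∑ᶠ b, pushWeight f w b = ∑ᶠ i, w i := by
  classical
  have := Fintype.ofFinite ι
  have := Fintype.ofFinite κ
  simp only [pushWeight_eq_sum, finsum_eq_sum_of_fintype]
  rw [Finset.sum_comm]
  simp

theorem pushWeight_add [Finite ι] (f : ι → κ) (v w : ι → ℝ) (b : κ) :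
    pushWeight f (fun i => v i + w i) b = pushWeight f v b + pushWeight f w b := by
  classical
  have := Fintype.ofFinite ι
  simp only [pushWeight_eq_sum, ← Finset.sum_add_distrib]
  exact Finset.sum_congr rfl fun i _ => by split_ifs <;> simp

theorem pushWeight_pushWeight [Finite ι] [Finite κ] {μ : Type*} (g : κ → μ) (f : ι → κ) (w : ι → ℝ) (b : μ) :
    pushWeight g (pushWeight f w) b = pushWeight (g ∘ f) w b := by
  classical
  have := Fintype.ofFinite ι
  have := Fintype.ofFinite κ
  simp only [pushWeight_eq_sum, ← Finset.sum_filter, Function.comp_apply]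
  simp only [Finset.sum_filter]
  rw [Finset.sum_congr rfl fun k _ => (by
    split_ifs <;> simp :
      (if g k = b then ∑ i, (if f i = k then w i else 0) else 0) =
        ∑ i, if f i = k then (if g k = b then w i else 0) else 0)]
  rw [Finset.sum_comm]
  simp

theorem pushWeight_comp_equiv {ι' : Type*} (e : ι' ≃ ι) (f : ι → κ) (w : ι → ℝ)
    (b : κ) : pushWeight (f ∘ e) (w ∘ e) b = pushWeight f w b :=
  finsum_comp_equiv e (f := fun i => ∑ᶠ (_ : f i = b), w i)

theorem pushWeight_apply_of_injective [Finite ι] {f : ι → κ} (hf : Function.Injective f) (w : ι → ℝ) (i : ι) :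
    pushWeight f w (f i) = w i := by
  classical
  have := Fintype.ofFinite ι
  simp [pushWeight_eq_sum, hf.eq_iff]

theorem pushWeight_eq_of_const [Finite ι] {f : ι → κ} {w : ι → ℝ} {b₀ : κ} (h : ∀ i, w i ≠ 0 → f i = b₀)
    (b : κ) [Decidable (b = b₀)] : pushWeight f w b = if b = b₀ then ∑ᶠ i, w i else 0 := by
  classical
  have := Fintype.ofFinite ι
  rw [pushWeight_eq_sum, finsum_eq_sum_of_fintype]
  split_ifs with hb
  · refine Finset.sum_congr rfl fun i _ => ?_
    by_cases hi : w i = 0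
    · simp [hi]
    · simp [h i hi, hb]
  · refine Finset.sum_eq_zero fun i _ => ?_
    by_cases hi : w i = 0
    · simp [hi]
    · simp [h i hi, Ne.symm hb]

theorem continuous_pushWeight [Finite ι] {X : Type*} [TopologicalSpace X] (f : ι → κ) {w : X → ι → ℝ}
    (hw : ∀ i, Continuous fun x => w x i) (b : κ) : Continuous fun x => pushWeight f (w x) b := by
  classical
  have := Fintype.ofFinite ι
  simp only [pushWeight_eq_sum]
  refine continuous_finsetSum _ fun i _ => ?_
  split_ifs
  · exact hw i
  · exact continuous_const

theorem pushWeight_smul {H : Type*} [Group H] [MulAction H ι] [MulAction H κ]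
    {f : ι → κ} (hf : ∀ (h : H) a, f (h • a) = h • f a) (h : H) (w : ι → ℝ)
    (b : κ) : pushWeight f (fun a => w (h⁻¹ • a)) b = pushWeight f w (h⁻¹ • b) := by
  rw [← pushWeight_comp_equiv (MulAction.toPerm h)]
  refine finsum_congr fun a => ?_
  simp only [Function.comp_apply, MulAction.toPerm_apply, hf, inv_smul_smul]
  exact finsum_congr_Prop (propext (eq_inv_smul_iff (g := h)).symm) fun _ => rfl

end Pushforward

/-! ### The realization as a compact Hausdorff space, functorial in the poset. -/

namespace PosetRealization

open unitInterval

variable {P Q R : Type*} [PartialOrder P] [Finite P] [PartialOrder Q] [Finite Q]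
  [PartialOrder R] [Finite R]

theorem isInducing_coord : Topology.IsInducing (coord : PosetRealization P → P → ℝ) := ⟨rfl⟩

theorem continuous_coord (a : P) : Continuous fun x : PosetRealization P => x.coord a :=
  (continuous_apply a).comp isInducing_coord.continuous

theorem coord_injective : Function.Injective (coord : PosetRealization P → P → ℝ) :=
  fun _ _ h => PosetRealization.ext h

theorem continuous_of_coord {X : Type*} [TopologicalSpace X] {f : X → PosetRealization P}
    (h : ∀ a, Continuous fun x => (f x).coord a) : Continuous f :=
  isInducing_coord.continuous_iff.2 (continuous_pi h)

instance : T2Space (PosetRealization P) :=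
  T2Space.of_injective_continuous coord_injective isInducing_coord.continuous

theorem coord_le_one (x : PosetRealization P) (a : P) : x.coord a ≤ 1 := by
  have := Fintype.ofFinite P
  rw [← x.sum_eq_one, finsum_eq_sum_of_fintype]
  exact Finset.single_le_sum (fun b _ => x.nonneg b) (Finset.mem_univ a)

theorem exists_coord_ne_zero (x : PosetRealization P) : ∃ a, x.coord a ≠ 0 := by
  by_contra! h
  have := x.sum_eq_one
  simp [h] at this

theorem le_or_le (x : PosetRealization P) {a b : P} (ha : x.coord a ≠ 0) (hb : x.coord b ≠ 0) :
    a ≤ b ∨ b ≤ a := x.isChain_support.total ha hb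

/-- Writes the chain condition as the vanishing of products over incomparable pairs, which is
visibly closed; compactness of `|P|` follows. -/
theorem range_coord : Set.range (coord : PosetRealization P → P → ℝ) =
    {w | (∀ a, 0 ≤ w a) ∧ ∑ᶠ a, w a = 1 ∧ ∀ a b, ¬ (a ≤ b ∨ b ≤ a) → w a * w b = 0} := by
  ext w
  constructor
  · rintro ⟨x, rfl⟩
    refine ⟨x.nonneg, x.sum_eq_one, fun a b hab => ?_⟩
    by_contra h
    exact hab (x.le_or_le (left_ne_zero_of_mul h) (right_ne_zero_of_mul h))
  · rintro ⟨h0, h1, h2⟩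
    refine ⟨⟨w, h0, h1, fun a ha b hb _ => ?_⟩, rfl⟩
    by_contra h
    exact mul_ne_zero ha hb (h2 a b h)

instance : CompactSpace (PosetRealization P) := by
  have := Fintype.ofFinite P
  rw [← isCompact_univ_iff, isInducing_coord.isCompact_iff, Set.image_univ]
  refine (isCompact_univ_pi fun _ : P => isCompact_Icc (a := (0 : ℝ)) (b := 1)).of_isClosed_subset
    ?_ ?_
  · simp only [range_coord, finsum_eq_sum_of_fintype, Set.ofPred_and, Set.ofPred_forall]
    refine (isClosed_iInter fun a => isClosed_le continuous_const (continuous_apply a)).inter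
      ((isClosed_eq (by fun_prop) continuous_const).inter ?_)
    exact isClosed_iInter fun a => isClosed_iInter fun b => isClosed_iInter fun _ =>
      isClosed_eq (by fun_prop) continuous_const
  · rintro _ ⟨x, rfl⟩ a -
    exact ⟨x.nonneg a, x.coord_le_one a⟩

theorem map_coord (f : P →o Q) (x : PosetRealization P) (b : Q) :
    (map f x).coord b = pushWeight f x.coord b := rfl

theorem map_id (x : PosetRealization P) : map OrderHom.id x = x :=
  PosetRealization.ext (funext fun a =>
    pushWeight_apply_of_injective (f := (OrderHom.id : P →o P)) Function.injective_id x.coord a)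

theorem map_map (g : Q →o R) (f : P →o Q) (x : PosetRealization P) :
    map g (map f x) = map (g.comp f) x :=
  PosetRealization.ext (funext fun b => pushWeight_pushWeight g f x.coord b)

theorem map_comp (g : Q →o R) (f : P →o Q) : map (g.comp f) = (map g).comp (map f) :=
  ContinuousMap.ext fun x => (map_map g f x).symm

theorem exists_of_map_coord_ne_zero {f : P →o Q} {x : PosetRealization P} {b : Q}
    (h : (map f x).coord b ≠ 0) : ∃ a, f a = b ∧ x.coord a ≠ 0 :=
  exists_of_pushWeight_ne_zero h

theorem map_coord_of_const {f : P →o Q} {x : PosetRealization P} {b₀ : Q}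
    (h : ∀ a, x.coord a ≠ 0 → f a = b₀) (b : Q) [Decidable (b = b₀)] :
    (map f x).coord b = if b = b₀ then 1 else 0 := by
  rw [map_coord, pushWeight_eq_of_const h, x.sum_eq_one]

theorem map_coord_apply {f : P →o Q} (hf : Function.Injective f) (x : PosetRealization P) (a : P) :
    (map f x).coord (f a) = x.coord a := pushWeight_apply_of_injective hf _ _

/-- A point supported on the image of an order embedding comes from the smaller poset. -/
theorem exists_map_eq {f : P →o Q} (hf : ∀ a b, f a ≤ f b ↔ a ≤ b) (y : PosetRealization Q)
    (hy : ∀ b, y.coord b ≠ 0 → ∃ a, f a = b) : ∃ x, map f x = y := by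
  have inj : Function.Injective f := fun a b h =>
    le_antisymm ((hf _ _).1 h.le) ((hf _ _).1 h.ge)
  have push : ∀ b, pushWeight f (y.coord ∘ f) b = y.coord b := fun b => by
    by_cases h : ∃ a, f a = b
    · obtain ⟨a, rfl⟩ := h
      exact pushWeight_apply_of_injective inj _ a
    · by_contra h'
      by_cases h0 : y.coord b = 0
      · rw [h0] at h'
        obtain ⟨a, ha, -⟩ := exists_of_pushWeight_ne_zero h'
        exact h ⟨a, ha⟩
      · exact h (hy b h0)
  refine ⟨⟨y.coord ∘ f, fun a => y.nonneg _, ?_, fun a ha b hb _ => ?_⟩,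
    PosetRealization.ext (funext push)⟩
  · rw [← finsum_pushWeight f, ← y.sum_eq_one]
    exact finsum_congr push
  · exact (y.le_or_le ha hb).imp (hf _ _).1 (hf _ _).1

/-- The segment between two points whose supports lie in a common chain. -/
def mix (s : I) (x y : PosetRealization P)
    (h : ∀ a b, x.coord a ≠ 0 → y.coord b ≠ 0 → a ≤ b ∨ b ≤ a) : PosetRealization P where
  coord a := (1 - s) * x.coord a + s * y.coord a
  nonneg a := add_nonneg (mul_nonneg (sub_nonneg.2 s.2.2) (x.nonneg a))
    (mul_nonneg s.2.1 (y.nonneg a))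
  sum_eq_one := by
    have := Fintype.ofFinite P
    have hx := x.sum_eq_one
    have hy := y.sum_eq_one
    rw [finsum_eq_sum_of_fintype] at hx hy ⊢
    rw [Finset.sum_add_distrib, ← Finset.mul_sum, ← Finset.mul_sum, hx, hy]
    ring
  isChain_support := by
    have key : ∀ a, (1 - (s : ℝ)) * x.coord a + s * y.coord a ≠ 0 →
        x.coord a ≠ 0 ∨ y.coord a ≠ 0 := by
      intro a ha
      by_contra! h
      simp [h.1, h.2] at ha
    intro a ha b hb _
    rcases key a ha with ha | ha <;> rcases key b hb with hb | hb
    · exact x.le_or_le ha hb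
    · exact h a b ha hb
    · exact (h b a hb ha).symm
    · exact y.le_or_le ha hb

section Action

variable {H : Type*} [Group H] [MulAction H P] [CovariantClass H P (· • ·) (· ≤ ·)]
  [MulAction H Q] [CovariantClass H Q (· • ·) (· ≤ ·)]

theorem smul_coord (h : H) (x : PosetRealization P) (a : P) :
    (h • x).coord a = x.coord (h⁻¹ • a) := rfl

theorem map_smul {f : P →o Q} (hf : ∀ (h : H) a, f (h • a) = h • f a) (h : H)
    (x : PosetRealization P) : map f (h • x) = h • map f x :=
  PosetRealization.ext (funext fun b => pushWeight_smul hf h x.coord b)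

end Action

/-! ### Comparable maps are homotopic -/

/-- The total weight above `a`. -/
noncomputable def weightAbove (x : PosetRealization P) (a : P) : ℝ :=
  ∑ᶠ (b : P) (_ : a < b), x.coord b

theorem weightAbove_eq_sum [Fintype P] [DecidableLT P] (x : PosetRealization P) (a : P) :
    x.weightAbove a = ∑ b, if a < b then x.coord b else 0 := by
  classical
  simp only [weightAbove, finsum_eq_sum_of_fintype, finsum_eq_if]

theorem weightAbove_nonneg (x : PosetRealization P) (a : P) : 0 ≤ x.weightAbove a :=
  finsum_nonneg fun b => finsum_nonneg fun _ => x.nonneg b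

theorem continuous_weightAbove (a : P) :
    Continuous fun x : PosetRealization P => x.weightAbove a := by
  classical
  have := Fintype.ofFinite P
  simp only [weightAbove_eq_sum]
  refine continuous_finsetSum _ fun b _ => ?_
  split_ifs
  · exact continuous_coord b
  · exact continuous_const

theorem weightAbove_add_le_one (x : PosetRealization P) (a : P) :
    x.weightAbove a + x.coord a ≤ 1 := by
  classical
  have := Fintype.ofFinite P
  rw [weightAbove_eq_sum, ← x.sum_eq_one, finsum_eq_sum_of_fintype]
  calc _ = ∑ b, ((if a < b then x.coord b else 0) + if a = b then x.coord b else 0) := by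
        rw [Finset.sum_add_distrib]; simp
    _ ≤ _ := Finset.sum_le_sum fun b _ => by
        split_ifs with h1 h2
        · exact absurd h2 h1.ne
        all_goals simp [x.nonneg b]

theorem weightAbove_add_le {x : PosetRealization P} {a b : P} (h : b < a) :
    x.weightAbove a + x.coord a ≤ x.weightAbove b := by
  classical
  have := Fintype.ofFinite P
  rw [weightAbove_eq_sum, weightAbove_eq_sum]
  calc _ = ∑ c, ((if a < c then x.coord c else 0) + if a = c then x.coord c else 0) := by
        rw [Finset.sum_add_distrib]; simp
    _ ≤ _ := Finset.sum_le_sum fun c _ => by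
        by_cases h1 : a < c
        · simp [h1, h1.ne, h.trans h1]
        · by_cases h2 : a = c
          · subst h2; simp [h]
          · simp only [h1, h2, if_false, add_zero]
            split_ifs
            exacts [x.nonneg c, le_rfl]

/-- The part of the weight at `a` lying among the topmost `t` of the total weight. -/
noncomputable def topWeight (t : I) (x : PosetRealization P) (a : P) : ℝ :=
  min (max (t - x.weightAbove a) 0) (x.coord a)

theorem topWeight_nonneg (t : I) (x : PosetRealization P) (a : P) : 0 ≤ x.topWeight t a :=
  le_min (le_max_right _ _) (x.nonneg a)

theorem topWeight_le (t : I) (x : PosetRealization P) (a : P) : x.topWeight t a ≤ x.coord a :=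
  min_le_right _ _

theorem topWeight_zero (x : PosetRealization P) (a : P) : x.topWeight 0 a = 0 := by
  have := x.weightAbove_nonneg a
  rw [topWeight, max_eq_right (by simpa using this), min_eq_left (x.nonneg a)]

theorem topWeight_one (x : PosetRealization P) (a : P) : x.topWeight 1 a = x.coord a := by
  have := x.weightAbove_add_le_one a
  exact min_eq_right (le_max_of_le_left (by simp only [Set.Icc.coe_one]; linarith))

/-- Stack the weights of the chain with larger elements on top and cut at depth `t`. If `b < a`,
then weight of `b` above the cut forces all the weight of `a` to be above it. -/
theorem le_of_topWeight {t : I} {x : PosetRealization P} {a b : P}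
    (ha : x.coord a - x.topWeight t a ≠ 0) (hb : x.topWeight t b ≠ 0) : a ≤ b := by
  have ha' : x.coord a ≠ 0 := fun h => by
    have h1 := x.topWeight_nonneg t a
    have h2 := x.topWeight_le t a
    exact ha (by linarith)
  have hb' : x.coord b ≠ 0 := fun h => by
    have h1 := x.topWeight_nonneg t b
    have h2 := x.topWeight_le t b
    exact hb (by linarith)
  by_contra hab
  have hlt : b < a := lt_of_le_not_ge ((x.le_or_le ha' hb').resolve_left hab) hab
  have h3 := x.weightAbove_add_le hlt
  have h4 : (t : ℝ) - x.weightAbove a < x.coord a := by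
    by_contra! h
    exact ha (sub_eq_zero.2 (min_eq_right (le_max_of_le_left h)).symm)
  have h5 : 0 < (t : ℝ) - x.weightAbove b := by
    by_contra! h
    exact hb (by rw [topWeight, max_eq_right h, min_eq_left (x.nonneg b)])
  linarith

theorem continuous_topWeight (a : P) :
    Continuous fun y : I × PosetRealization P => y.2.topWeight y.1 a :=
  (((continuous_subtype_val.comp continuous_fst).sub
    ((continuous_weightAbove a).comp continuous_snd)).max continuous_const).min
    ((continuous_coord a).comp continuous_snd)

/-- At time `t`, the topmost `t` of the weight is moved by `g` and the rest by `f`. -/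
noncomputable def slidePoint (f g : P →o Q) (hfg : ∀ a, f a ≤ g a) (t : I)
    (x : PosetRealization P) : PosetRealization Q where
  coord b := pushWeight f (fun a => x.coord a - x.topWeight t a) b + pushWeight g (x.topWeight t) b
  nonneg b := add_nonneg
    (pushWeight_nonneg f (fun a => sub_nonneg.2 (x.topWeight_le t a)) b)
    (pushWeight_nonneg g (x.topWeight_nonneg t) b)
  sum_eq_one := by
    rw [finsum_add_distrib (Set.toFinite _) (Set.toFinite _), finsum_pushWeight,
      finsum_pushWeight, ← finsum_add_distrib (Set.toFinite _) (Set.toFinite _), ← x.sum_eq_one]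
    simp
  isChain_support := by
    have key : ∀ b, pushWeight f (fun a => x.coord a - x.topWeight t a) b +
        pushWeight g (x.topWeight t) b ≠ 0 →
        (∃ a, f a = b ∧ x.coord a - x.topWeight t a ≠ 0) ∨ ∃ a, g a = b ∧ x.topWeight t a ≠ 0 := by
      intro b hb
      by_cases h : pushWeight g (x.topWeight t) b = 0
      · rw [h, add_zero] at hb
        exact Or.inl (exists_of_pushWeight_ne_zero hb)
      · exact Or.inr (exists_of_pushWeight_ne_zero h)
    have supp1 : ∀ a, x.coord a - x.topWeight t a ≠ 0 → x.coord a ≠ 0 := fun a ha h => by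
      have h1 := x.topWeight_nonneg t a
      have h2 := x.topWeight_le t a
      exact ha (by linarith)
    have supp2 : ∀ a, x.topWeight t a ≠ 0 → x.coord a ≠ 0 := fun a ha h => by
      have h1 := x.topWeight_nonneg t a
      have h2 := x.topWeight_le t a
      exact ha (by linarith)
    intro b hb c hc _
    rcases key b hb with ⟨a, rfl, ha⟩ | ⟨a, rfl, ha⟩ <;>
      rcases key c hc with ⟨d, rfl, hd⟩ | ⟨d, rfl, hd⟩
    · exact (x.le_or_le (supp1 a ha) (supp1 d hd)).imp (fun h => f.monotone h)
        fun h => f.monotone h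
    -- This case is why the topmost weight moves first: `a ≤ d` gives `f a ≤ g a ≤ g d`, whereas `g
    -- a` and `f d` need not be comparable.
    · exact Or.inl ((hfg a).trans (g.monotone (le_of_topWeight ha hd)))
    · exact Or.inr ((hfg d).trans (g.monotone (le_of_topWeight hd ha)))
    · exact (x.le_or_le (supp2 a ha) (supp2 d hd)).imp (fun h => g.monotone h)
        fun h => g.monotone h

/-- Comparable poset maps induce homotopic maps of realizations. -/
noncomputable def slide (f g : P →o Q) (hfg : ∀ a, f a ≤ g a) : (map f).Homotopy (map g) where
  toFun y := slidePoint f g hfg y.1 y.2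
  continuous_toFun := continuous_of_coord fun b =>
    (continuous_pushWeight f (fun a => ((continuous_coord a).comp continuous_snd).sub
      (continuous_topWeight a)) b).add (continuous_pushWeight g continuous_topWeight b)
  map_zero_left x := PosetRealization.ext (funext fun b => by
    change pushWeight f (fun a => x.coord a - x.topWeight 0 a) b +
      pushWeight g (x.topWeight 0) b = pushWeight f x.coord b
    rw [funext x.topWeight_zero, show pushWeight g (fun _ => 0) b = 0 by simp [pushWeight]]
    simp)
  map_one_left x := PosetRealization.ext (funext fun b => by
    change pushWeight f (fun a => x.coord a - x.topWeight 1 a) b +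
      pushWeight g (x.topWeight 1) b = pushWeight g x.coord b
    rw [funext x.topWeight_one]
    simp [pushWeight])

theorem slide_coord (f g : P →o Q) (hfg : ∀ a, f a ≤ g a) (t : I) (x : PosetRealization P)
    (b : Q) : (slide f g hfg (t, x)).coord b =
      pushWeight f (fun a => x.coord a - x.topWeight t a) b + pushWeight g (x.topWeight t) b := rfl

/-- The homotopy stays in the fibres of `φ`. With `φ` the first projection of pairs, the contraction
of the links does not move the removed element. -/
theorem map_slide {f g : P →o Q} (hfg : ∀ a, f a ≤ g a) (φ : Q →o R)
    (hφ : φ.comp f = φ.comp g) (t : I) (x : PosetRealization P) :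
    map φ (slide f g hfg (t, x)) = map (φ.comp f) x := by
  refine PosetRealization.ext (funext fun b => ?_)
  have e : (φ ∘ g : P → R) = φ ∘ f := congrArg (fun k : P →o R => (k : P → R)) hφ.symm
  rw [map_coord, map_coord, funext (slide_coord f g hfg t x), pushWeight_add,
    pushWeight_pushWeight, pushWeight_pushWeight, e, ← pushWeight_add]
  simp only [sub_add_cancel]
  rfl

section Action

variable {H : Type*} [Group H] [MulAction H P] [CovariantClass H P (· • ·) (· ≤ ·)]
  [MulAction H Q] [CovariantClass H Q (· • ·) (· ≤ ·)]

theorem weightAbove_smul (h : H) (x : PosetRealization P) (a : P) :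
    (h • x).weightAbove a = x.weightAbove (h⁻¹ • a) := by
  have hle : ∀ {c d : P} (h : H), c ≤ d → h • c ≤ h • d := fun h hcd => CovariantClass.elim h hcd
  have hiff : ∀ (h : H) (c d : P), h • c ≤ h • d ↔ c ≤ d := fun h c d =>
    ⟨fun e => by simpa using hle h⁻¹ e, hle h⟩
  rw [weightAbove, weightAbove, ← finsum_comp_equiv (MulAction.toPerm h⁻¹)
    (f := fun b => ∑ᶠ (_ : h⁻¹ • a < b), x.coord b)]
  refine finsum_congr fun b => finsum_congr_Prop (propext ?_) fun _ => rfl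
  rw [MulAction.toPerm_apply, lt_iff_le_not_ge, lt_iff_le_not_ge, hiff, hiff]

theorem topWeight_smul (t : I) (h : H) (x : PosetRealization P) (a : P) :
    (h • x).topWeight t a = x.topWeight t (h⁻¹ • a) := by
  rw [topWeight, topWeight, weightAbove_smul, smul_coord]

theorem slide_smul {f g : P →o Q} (hfg : ∀ a, f a ≤ g a) (hf : ∀ (h : H) a, f (h • a) = h • f a)
    (hg : ∀ (h : H) a, g (h • a) = h • g a) (h : H) (t : I) (x : PosetRealization P) :
    slide f g hfg (t, h • x) = h • slide f g hfg (t, x) := by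
  refine PosetRealization.ext (funext fun b => ?_)
  rw [smul_coord, slide_coord, slide_coord, funext (topWeight_smul t h x)]
  simp only [smul_coord]
  rw [pushWeight_smul hg h (x.topWeight t),
    ← pushWeight_smul hf h fun a => x.coord a - x.topWeight t a]

end Action

end PosetRealization

/-! ### Removing elements with contractible upper link -/

section Removal

open unitInterval PosetRealization

variable {H P : Type*} [Group H] [PartialOrder P] [MulAction H P]

instance subMulActionCovariant [CovariantClass H P (· • ·) (· ≤ ·)] (X : SubMulAction H P) :
    CovariantClass H X (· • ·) (· ≤ ·) where
  elim h _ _ hab := (CovariantClass.elim h (Subtype.coe_le_coe.2 hab) : h • (_ : P) ≤ h • (_ : P))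

instance prodCovariant [CovariantClass H P (· • ·) (· ≤ ·)] :
    CovariantClass H (P × P) (· • ·) (· ≤ ·) where
  elim h _ _ hab := ⟨(CovariantClass.elim h hab.1 : h • (_ : P) ≤ h • (_ : P)),
    (CovariantClass.elim h hab.2 : h • (_ : P) ≤ h • (_ : P))⟩

theorem SubMulAction.smul_mem_iff_mem {H P : Type*} [Group H] [MulAction H P]
    (X : SubMulAction H P) (h : H) {a : P} :
    h • a ∈ X ↔ a ∈ X :=
  ⟨fun ha => by simpa using X.smul_mem h⁻¹ ha, fun ha => X.smul_mem h ha⟩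

theorem smul_lt_smul_of_covariant [CovariantClass H P (· • ·) (· ≤ ·)] (h : H) {a b : P}
    (hab : a < b) : h • a < h • b :=
  lt_of_le_of_ne (CovariantClass.elim h hab.le) fun e => hab.ne (MulAction.injective h e)

/-- The inclusion of invariant subposets. -/
def SubMulAction.inclusionHom {D S : SubMulAction H P} (h : D ≤ S) : D →o S where
  toFun a := ⟨a, h a.2⟩
  monotone' _ _ hab := hab

/-- Data contracting, for each `a ∈ S \ D`, the poset `{b ∈ S ∣ a < b}` through
`b ≥ α a b ≤ β a b ≥ γ a`, equivariantly in `a`. -/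
structure IsLinkContraction (S D : SubMulAction H P) (α β : P → P → P) (γ : P → P) : Prop where
  α_mem : ∀ {a b}, a ∈ S → a ∉ D → b ∈ S → a < b → α a b ∈ S
  lt_α : ∀ {a b}, a ∈ S → a ∉ D → b ∈ S → a < b → a < α a b
  α_le : ∀ {a b}, a ∈ S → a ∉ D → b ∈ S → a < b → α a b ≤ b
  α_mono : ∀ {a b b'}, b ≤ b' → α a b ≤ α a b'
  α_smul : ∀ (h : H) a b, α (h • a) (h • b) = h • α a b
  β_mem : ∀ {a b}, a ∈ S → a ∉ D → b ∈ S → a < b → β a b ∈ S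
  α_le_β : ∀ {a b}, a ∈ S → a ∉ D → b ∈ S → a < b → α a b ≤ β a b
  β_mono : ∀ {a b b'}, b ≤ b' → β a b ≤ β a b'
  β_smul : ∀ (h : H) a b, β (h • a) (h • b) = h • β a b
  γ_mem : ∀ {a}, a ∈ S → a ∉ D → γ a ∈ S
  lt_γ : ∀ {a}, a ∈ S → a ∉ D → a < γ a
  γ_le_β : ∀ {a b}, a ∈ S → a ∉ D → b ∈ S → a < b → γ a ≤ β a b
  γ_smul : ∀ (h : H) a, γ (h • a) = h • γ a

/-- The pairs `a < b` in `S` with `a ∉ L`. -/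
def linkPairs [CovariantClass H P (· • ·) (· ≤ ·)] (S L : SubMulAction H P) :
    SubMulAction H (P × P) where
  carrier := {e | e.1 ∈ S ∧ e.1 ∉ L ∧ e.2 ∈ S ∧ e.1 < e.2}
  smul_mem' h _ he := ⟨S.smul_mem h he.1, fun h' => he.2.1 ((L.smul_mem_iff_mem h).1 h'),
    S.smul_mem h he.2.2.1, smul_lt_smul_of_covariant h he.2.2.2⟩

variable [Finite P] [CovariantClass H P (· • ·) (· ≤ ·)]

/-- Removing an invariant set of minimal elements with contractible links. -/
theorem isEquivariantHomotopyEquiv_of_minimal {S L : SubMulAction H P} (hLS : L ≤ S)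
    (hmin : ∀ a ∈ S, a ∉ L → ∀ b ∈ S, b ≤ a → b = a) {α β : P → P → P} {γ : P → P}
    (C : IsLinkContraction S L α β γ) :
    IsEquivariantHomotopyEquiv H (PosetRealization.map (SubMulAction.inclusionHom hLS)) := by
  classical
  let E := linkPairs S L
  have mem_L : ∀ e : E, e.1.2 ∈ L := fun e => by
    by_contra h
    exact e.2.2.2.2.ne (hmin _ e.2.2.2.1 h _ e.2.1 e.2.2.2.2.le)
  -- Comparable pairs share their first member, so `|E|` is the disjoint union of the upper links of
  -- the removed elements, and maps on `E` need monotonicity in the second member only.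
  have fst_eq : ∀ {e e' : E}, e ≤ e' → e.1.1 = e'.1.1 := fun {e e'} h =>
    hmin _ e'.2.1 e'.2.2.1 _ e.2.1 h.1
  let fst : E →o S := ⟨fun e => ⟨e.1.1, e.2.1⟩, fun _ _ h => h.1⟩
  let snd : E →o S := ⟨fun e => ⟨e.1.2, e.2.2.2.1⟩, fun _ _ h => h.2⟩
  let π : E →o L := ⟨fun e => ⟨e.1.2, mem_L e⟩, fun _ _ h => h.2⟩
  let A : E →o E := ⟨fun e => ⟨(e.1.1, α e.1.1 e.1.2), e.2.1, e.2.2.1,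
      C.α_mem e.2.1 e.2.2.1 e.2.2.2.1 e.2.2.2.2, C.lt_α e.2.1 e.2.2.1 e.2.2.2.1 e.2.2.2.2⟩,
    fun e e' h => ⟨h.1, by
      change α e.1.1 e.1.2 ≤ α e'.1.1 e'.1.2
      rw [fst_eq h]; exact C.α_mono h.2⟩⟩
  let B : E →o E := ⟨fun e => ⟨(e.1.1, β e.1.1 e.1.2), e.2.1, e.2.2.1,
      C.β_mem e.2.1 e.2.2.1 e.2.2.2.1 e.2.2.2.2,
      (C.lt_α e.2.1 e.2.2.1 e.2.2.2.1 e.2.2.2.2).trans_le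
        (C.α_le_β e.2.1 e.2.2.1 e.2.2.2.1 e.2.2.2.2)⟩,
    fun e e' h => ⟨h.1, by
      change β e.1.1 e.1.2 ≤ β e'.1.1 e'.1.2
      rw [fst_eq h]; exact C.β_mono h.2⟩⟩
  let K : E →o E := ⟨fun e => ⟨(e.1.1, γ e.1.1), e.2.1, e.2.2.1, C.γ_mem e.2.1 e.2.2.1,
      C.lt_γ e.2.1 e.2.2.1⟩,
    fun e e' h => ⟨h.1, by
      change γ e.1.1 ≤ γ e'.1.1
      rw [fst_eq h]⟩⟩
  have AI : ∀ e, A e ≤ OrderHom.id e := fun e =>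
    ⟨le_rfl, C.α_le e.2.1 e.2.2.1 e.2.2.2.1 e.2.2.2.2⟩
  have AB : ∀ e, A e ≤ B e := fun e => ⟨le_rfl, C.α_le_β e.2.1 e.2.2.1 e.2.2.2.1 e.2.2.2.2⟩
  have KB : ∀ e, K e ≤ B e := fun e => ⟨le_rfl, C.γ_le_β e.2.1 e.2.2.1 e.2.2.2.1 e.2.2.2.2⟩
  have eA : ∀ (h : H) e, A (h • e) = h • A e := fun h e =>
    Subtype.ext (Prod.ext rfl (C.α_smul h _ _))
  have eB : ∀ (h : H) e, B (h • e) = h • B e := fun h e =>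
    Subtype.ext (Prod.ext rfl (C.β_smul h _ _))
  have eK : ∀ (h : H) e, K (h • e) = h • K e := fun h e =>
    Subtype.ext (Prod.ext rfl (C.γ_smul h _))
  have idmap : map (OrderHom.id : E →o E) = ContinuousMap.id _ := ContinuousMap.ext map_id
  -- the fibrewise contraction
  obtain ⟨Γ, hΓ, Γ_fst⟩ : ∃ Γ : (ContinuousMap.id (PosetRealization E)).Homotopy (map K),
      (∀ (h : H) t z, Γ (t, h • z) = h • Γ (t, z)) ∧ ∀ t z, map fst (Γ (t, z)) = map fst z := by
    rw [← idmap]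
    -- The contraction follows the zigzag `id ≥ A ≤ B ≥ K`, all of whose maps preserve the first
    -- member; `K` is constant on each link.
    let Γ₁ := slide A B AB
    let Γ₂ := (slide K B KB).symm
    let Γ₀ := (slide A OrderHom.id AI).symm
    refine ⟨Γ₀.trans (Γ₁.trans Γ₂), fun h t z => ?_, fun t z => ?_⟩
    all_goals
      obtain ⟨t', e | e⟩ := Γ₀.trans_apply_eq_or (Γ₁.trans Γ₂) t
      · simp only [e]
        first
        | exact slide_smul AI eA (fun _ _ => rfl) h _ z
        | exact map_slide AI fst rfl _ z
      · obtain ⟨t'', e' | e'⟩ := Γ₁.trans_apply_eq_or Γ₂ t'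
        · simp only [e, e']
          first
          | exact slide_smul AB eA eB h _ z
          | exact map_slide AB fst rfl _ z
        · simp only [e, e']
          first
          | exact slide_smul KB eK eB h _ z
          | exact map_slide KB fst rfl _ z
  -- every point of the space of pairs lies over a single removed element
  have base : ∀ z : PosetRealization E, ∃ a : S, a.1 ∉ L ∧
      (∀ e, z.coord e ≠ 0 → fst e = a) ∧ ∀ b, (map fst z).coord b = if b = a then 1 else 0 := by
    intro z
    obtain ⟨e₀, h₀⟩ := z.exists_coord_ne_zero
    have h : ∀ e, z.coord e ≠ 0 → fst e = fst e₀ := fun e he => Subtype.ext (by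
      rcases z.le_or_le he h₀ with h | h
      · exact fst_eq h
      · exact (fst_eq h).symm)
    exact ⟨fst e₀, e₀.2.2.1, h, fun b => map_coord_of_const h b⟩
  have mix_chain : ∀ (z : PosetRealization E) (b a : S), (map snd z).coord b ≠ 0 →
      (map fst z).coord a ≠ 0 → b ≤ a ∨ a ≤ b := by
    intro z b a hb ha
    obtain ⟨a₀, -, h, -⟩ := base z
    obtain ⟨e, rfl, he⟩ := exists_of_map_coord_ne_zero hb
    obtain ⟨e', rfl, he'⟩ := exists_of_map_coord_ne_zero ha
    refine Or.inr ?_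
    rw [(h e' he').trans (h e he).symm]
    exact e.2.2.2.2.le
  -- The segment from the point of the link to the vertex of the removed element, which is the apex.
  -- The height is thus the coordinate at that element.
  let c : C(PosetRealization E × I, PosetRealization S) :=
    { toFun := fun y => mix y.2 (map snd y.1) (map fst y.1) (mix_chain y.1)
      continuous_toFun := by
        refine continuous_of_coord fun b => ?_
        have h1 := (continuous_coord b).comp ((map snd).continuous.comp
          (continuous_fst (X := PosetRealization E) (Y := I)))
        have h2 := (continuous_coord b).comp ((map fst).continuous.comp
          (continuous_fst (X := PosetRealization E) (Y := I)))
        have h3 : Continuous fun y : PosetRealization E × I => (y.2 : ℝ) := by fun_prop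
        exact ((continuous_const.sub h3).mul h1).add (h3.mul h2) }
  have c_coord : ∀ z s b, (c (z, s)).coord b =
      (1 - s) * (map snd z).coord b + s * (map fst z).coord b := fun _ _ _ => rfl
  have snd_out : ∀ (z : PosetRealization E) (a : S), a.1 ∉ L → (map snd z).coord a = 0 := by
    intro z a ha
    by_contra h
    obtain ⟨e, rfl, -⟩ := exists_of_map_coord_ne_zero h
    exact ha (mem_L e)
  have incl_out : ∀ (l : PosetRealization L) (a : S), a.1 ∉ L →
      (map (SubMulAction.inclusionHom hLS) l).coord a = 0 := by
    intro l a ha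
    by_contra h
    obtain ⟨e, rfl, -⟩ := exists_of_map_coord_ne_zero h
    exact ha e.2
  have c_out : ∀ z s a, a.1 ∉ L → (c (z, s)).coord a = s * (map fst z).coord a := by
    intro z s a ha
    rw [c_coord, snd_out z a ha, mul_zero, zero_add]
  refine isEquivariantHomotopyEquiv_of_cone _ (map π) c Γ (fun h x => PosetRealization.map_smul (fun _ _ => rfl) h x)
    ?_ hΓ ?_ ?_ ?_ ?_ ?_ ?_ ?_
  · intro h z s
    refine PosetRealization.ext (funext fun b => ?_)
    rw [c_coord, smul_coord, c_coord, PosetRealization.map_smul (fun _ _ => rfl), PosetRealization.map_smul (fun _ _ => rfl),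
      smul_coord, smul_coord]
  · intro x y hxy
    have inj : Function.Injective (SubMulAction.inclusionHom hLS) := fun a b h =>
      Subtype.ext (congrArg (fun x : S => (x : P)) h)
    refine PosetRealization.ext (funext fun a => ?_)
    rw [← map_coord_apply inj x, ← map_coord_apply inj y, hxy]
  · intro z
    rw [map_map]
    refine PosetRealization.ext (funext fun b => ?_)
    rw [c_coord]
    simp only [Set.Icc.coe_zero, sub_zero, one_mul, zero_mul, add_zero]
    rfl
  · intro z s l h
    obtain ⟨a, ha, -, hz⟩ := base z
    have := c_out z s a ha
    rw [h, incl_out l a ha, hz, if_pos rfl, mul_one] at this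
    exact Subtype.ext this.symm
  · intro z s z' s' h
    obtain ⟨a, ha, ha', hz⟩ := base z
    obtain ⟨b, hb, hb', hz'⟩ := base z'
    have h1 := c_out z s a ha
    rw [h, c_out z' s' a ha, hz, if_pos rfl, mul_one, hz'] at h1
    have h2 := c_out z' s' b hb
    rw [← h, c_out z s b hb, hz', if_pos rfl, mul_one, hz] at h2
    by_cases hab : a = b
    · subst hab
      rw [if_pos rfl, mul_one] at h1
      obtain rfl : s' = s := Subtype.ext h1
      refine ⟨rfl, ?_⟩
      by_cases hs : s' = 1
      · exact Or.inr (Or.inl hs)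
      · refine Or.inr (Or.inr ?_)
        have hs' : 1 - (s' : ℝ) ≠ 0 := fun h => hs (Subtype.ext (by
          rw [Set.Icc.coe_one]; linarith))
        have key : ∀ b, (map snd z).coord b = (map snd z').coord b := fun b => by
          have := c_coord z s' b
          rw [h, c_coord, hz, hz'] at this
          exact (mul_left_cancel₀ hs' (add_right_cancel this)).symm
        -- Over a fixed removed element a pair is determined by its second member, so `z` can be
        -- recovered from `map snd z`, which `key` reads off below the apex.
        have val : ∀ y : PosetRealization E, (∀ e, y.coord e ≠ 0 → fst e = a) →
            ∀ e, fst e = a → y.coord e = (map snd y).coord (snd e) := by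
          intro y hy e he
          have := Fintype.ofFinite E
          rw [map_coord, pushWeight_eq_sum, Finset.sum_eq_single e]
          · simp
          · intro e' _ hne
            by_cases h0 : y.coord e' = 0
            · simp [h0]
            · rw [if_neg]
              intro h2
              refine hne (Subtype.ext (Prod.ext ?_ (congrArg (fun x : S => (x : P)) h2)))
              exact congrArg (fun x : S => (x : P)) ((hy e' h0).trans he.symm)
          · simp
        refine PosetRealization.ext (funext fun e => ?_)
        by_cases he : fst e = a
        · rw [val z ha' e he, val z' hb' e he, key]
        · rw [not_imp_comm.1 (ha' e) he, not_imp_comm.1 (hb' e) he]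
    · rw [if_neg hab, mul_zero] at h1
      rw [if_neg (Ne.symm hab), mul_zero] at h2
      have hs : s = 0 := Subtype.ext h1.symm
      have hs' : s' = 0 := Subtype.ext h2.symm
      exact ⟨hs.trans hs'.symm, Or.inl hs⟩
  · intro z z' h
    obtain ⟨a, ha, ha', hz⟩ := base z
    obtain ⟨b, hb, hb', hz'⟩ := base z'
    have h1 := c_out z 1 a ha
    rw [h, c_out z' 1 a ha, hz, if_pos rfl, hz'] at h1
    obtain rfl : a = b := by
      by_contra hab
      simp [hab] at h1
    have hv : (a.1, γ a.1) ∈ E := ⟨a.2, ha, C.γ_mem a.2 ha, C.lt_γ a.2 ha⟩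
    have hK : ∀ e, fst e = a → K e = ⟨_, hv⟩ := fun e he => by
      subst he
      rfl
    refine PosetRealization.ext (funext fun e => ?_)
    rw [map_coord_of_const (fun e he => hK e (ha' e he)),
      map_coord_of_const (fun e he => hK e (hb' e he))]
  · intro t z
    refine PosetRealization.ext (funext fun b => ?_)
    rw [c_coord, c_coord, Γ_fst]
    simp
  · intro x
    by_cases hx : ∀ a : S, a.1 ∉ L → x.coord a = 0
    · refine Or.inl (exists_map_eq (fun _ _ => Iff.rfl) x fun b hb => ?_)
      by_contra h
      refine hb (hx b fun hb' => h ⟨⟨b, hb'⟩, rfl⟩)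
    · push Not at hx
      obtain ⟨a, ha, hxa⟩ := hx
      refine Or.inr ?_
      have hv : (a.1, γ a.1) ∈ E := ⟨a.2, ha, C.γ_mem a.2 ha, C.lt_γ a.2 ha⟩
      have hother : ∀ b, x.coord b ≠ 0 → b ≠ a → a < b := by
        intro b hb hba
        rcases x.le_or_le hb hxa with h | h
        · exact absurd (Subtype.ext (hmin _ a.2 ha _ b.2 h)) hba
        · exact lt_of_le_of_ne h hba.symm
      have hsum : x.coord a + ∑ᶠ b, (if b = a then 0 else x.coord b) = 1 := by
        have := Fintype.ofFinite S
        rw [← x.sum_eq_one, finsum_eq_sum_of_fintype, finsum_eq_sum_of_fintype]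
        rw [← Finset.add_sum_erase _ _ (Finset.mem_univ a),
          ← Finset.add_sum_erase _ _ (Finset.mem_univ a)]
        rw [if_pos rfl, zero_add]
        congr 1
        exact Finset.sum_congr rfl fun b hb => if_neg (Finset.ne_of_mem_erase hb)
      let s : I := ⟨x.coord a, x.nonneg a, x.coord_le_one a⟩
      -- At the apex any point of the link will do, and `(a, γ a)` shows that there is one.
      -- Otherwise the remaining weights, rescaled to total 1, give the point of the link.
      by_cases hs : x.coord a = 1
      · have h0 : ∀ b, b ≠ a → x.coord b = 0 := by
          have := Fintype.ofFinite S
          rw [hs, finsum_eq_sum_of_fintype] at hsum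
          have h1 := (Finset.sum_eq_zero_iff_of_nonneg (fun b _ => by
            split_ifs
            exacts [le_rfl, x.nonneg b])).1 (by linarith : ∑ b, (if b = a then 0 else x.coord b) = 0)
          intro b hb
          simpa [hb] using h1 b (Finset.mem_univ b)
        let one : PosetRealization Unit := ⟨fun _ => 1, fun _ => zero_le_one,
          by rw [finsum_eq_sum_of_fintype]; simp,
          fun _ _ _ _ h => absurd rfl h⟩
        let v : Unit →o E := ⟨fun _ => ⟨_, hv⟩, fun _ _ _ => le_rfl⟩
        refine ⟨map v one, s, PosetRealization.ext (funext fun b => ?_)⟩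
        rw [c_coord, map_map, map_map, map_coord_of_const (f := fst.comp v) (b₀ := a) (fun _ _ => rfl)]
        change (1 - x.coord a) * _ + x.coord a * _ = _
        rw [hs]
        by_cases hb : b = a
        · simp [hb, hs]
        · simp [hb, h0 b hb]
      · have hs' : 0 < 1 - x.coord a :=
          sub_pos.2 (lt_of_le_of_ne (x.coord_le_one a) hs)
        let y : PosetRealization S :=
          { coord := fun b => (if b = a then 0 else x.coord b) / (1 - x.coord a)
            nonneg := fun b => div_nonneg (by split_ifs; exacts [le_rfl, x.nonneg b]) hs'.le
            sum_eq_one := by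
              have := Fintype.ofFinite S
              rw [finsum_eq_sum_of_fintype] at hsum ⊢
              rw [← Finset.sum_div, div_eq_one_iff_eq hs'.ne']
              linarith
            isChain_support := by
              have key : ∀ b, (if b = a then 0 else x.coord b) / (1 - x.coord a) ≠ 0 →
                  x.coord b ≠ 0 := by
                intro b hb h
                simp [h] at hb
              intro b hb d hd _
              exact x.le_or_le (key b hb) (key d hd) }
        let j : {b : S // a < b} →o S := ⟨Subtype.val, fun _ _ h => h⟩
        let k : {b : S // a < b} →o E :=
          ⟨fun b => ⟨(a.1, b.1.1), a.2, ha, b.1.2, b.2⟩, fun _ _ h => ⟨le_rfl, h⟩⟩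
        obtain ⟨w, hw⟩ := exists_map_eq (f := j) (fun _ _ => Iff.rfl) y fun b hb => by
          have hba : b ≠ a := fun e => hb (by simp [y, e])
          have hb0 : x.coord b ≠ 0 := fun e => hb (by simp [y, e])
          exact ⟨⟨b, hother b hb0 hba⟩, rfl⟩
        refine ⟨map k w, s, PosetRealization.ext (funext fun b => ?_)⟩
        rw [c_coord, map_map, map_map, map_coord_of_const (f := fst.comp k) (b₀ := a) (fun _ _ => rfl),
          show snd.comp k = j from rfl, hw]
        change (1 - x.coord a) * ((if b = a then 0 else x.coord b) / (1 - x.coord a)) +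
          x.coord a * (if b = a then 1 else 0) = x.coord b
        rw [mul_div_cancel₀ _ hs'.ne']
        by_cases hb : b = a
        · simp [hb]
        · simp [hb]

/-- An invariant up-closed subposet `D ⊆ S`, such that the upper link of every element of `S \ D` is
contractible, includes into `S` by an equivariant homotopy equivalence. -/
theorem isEquivariantHomotopyEquiv_of_isLinkContraction {S D : SubMulAction H P} (hDS : D ≤ S)
    (hup : ∀ a ∈ D, ∀ b ∈ S, a ≤ b → b ∈ D) {α β : P → P → P} {γ : P → P}
    (C : IsLinkContraction S D α β γ) :
    IsEquivariantHomotopyEquiv H (PosetRealization.map (SubMulAction.inclusionHom hDS)) := by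
  induction hn : Set.ncard {a | a ∈ S ∧ a ∉ D} using Nat.strong_induction_on generalizing S with
  | _ n ih =>
  by_cases hSD : S ≤ D
  · obtain rfl := le_antisymm hSD hDS
    have : PosetRealization.map (SubMulAction.inclusionHom hDS) = ContinuousMap.id _ :=
      ContinuousMap.ext fun x => map_id x
    rw [this]
    exact .refl
  have hcov : ∀ (h : H) {a b : P}, a ≤ b → h • a ≤ h • b := fun h _ _ hab =>
    CovariantClass.elim h hab
  -- As `D` is up-closed, this omits exactly the minimal elements of `S` that lie outside `D`.
  -- Removing all of them at once keeps the subposet invariant.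
  let L : SubMulAction H P :=
    { carrier := {b | b ∈ S ∧ ∃ a ∈ S, a ≤ b ∧ (a ∈ D ∨ a ≠ b)}
      smul_mem' := by
        rintro h b ⟨hb, a, ha, hab, h'⟩
        refine ⟨S.smul_mem h hb, h • a, S.smul_mem h ha, hcov h hab, h'.imp (D.smul_mem h) ?_⟩
        exact fun hne e => hne (MulAction.injective h e) }
  have hDL : D ≤ L := fun a ha => ⟨hDS ha, a, hDS ha, le_rfl, Or.inl ha⟩
  have hLS : L ≤ S := fun a ha => ha.1
  have mem_L : ∀ {a b}, a ∈ S → b ∈ S → a < b → b ∈ L := fun ha hb hab =>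
    ⟨hb, _, ha, hab.le, Or.inr hab.ne⟩
  have h1 : IsEquivariantHomotopyEquiv H
      (PosetRealization.map (SubMulAction.inclusionHom hLS)) := by
    refine isEquivariantHomotopyEquiv_of_minimal hLS (fun a ha haL b hb hba => ?_)
      (α := α) (β := β) (γ := γ) ?_
    · by_contra hne
      exact haL (mem_L hb ha (lt_of_le_of_ne hba hne))
    · exact
        { C with
          α_mem := fun ha ha' => C.α_mem ha fun h => ha' (hDL h)
          lt_α := fun ha ha' => C.lt_α ha fun h => ha' (hDL h)
          α_le := fun ha ha' => C.α_le ha fun h => ha' (hDL h)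
          β_mem := fun ha ha' => C.β_mem ha fun h => ha' (hDL h)
          α_le_β := fun ha ha' => C.α_le_β ha fun h => ha' (hDL h)
          γ_mem := fun ha ha' => C.γ_mem ha fun h => ha' (hDL h)
          lt_γ := fun ha ha' => C.lt_γ ha fun h => ha' (hDL h)
          γ_le_β := fun ha ha' => C.γ_le_β ha fun h => ha' (hDL h) }
  have h2 : IsEquivariantHomotopyEquiv H
      (PosetRealization.map (SubMulAction.inclusionHom hDL)) := by
    refine ih _ ?_ hDL (fun a ha b hb => hup a ha b hb.1) ?_ rfl
    · rw [← hn]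
      refine Set.ncard_lt_ncard ?_ (Set.toFinite _)
      refine ⟨fun a ha => ⟨ha.1.1, ha.2⟩, fun hsub => ?_⟩
      obtain ⟨m, hm⟩ := (Set.toFinite {a | a ∈ S ∧ a ∉ D}).exists_minimal (by
        obtain ⟨a, ha, ha'⟩ := Set.not_subset.1 hSD
        exact ⟨a, ha, ha'⟩)
      obtain ⟨-, a, ha, ham, h⟩ := (hsub hm.1).1
      have haD : a ∉ D := fun h => hm.1.2 (hup a h m hm.1.1 ham)
      exact h.elim haD fun hne => hne (le_antisymm ham (hm.2 ⟨ha, haD⟩ ham))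
    -- Everything in `S` strictly above an element of `S` lies in `L`, so the remaining upper links
    -- are unchanged and the same contraction data apply.
    · exact
        { C with
          α_mem := fun ha ha' hb hab => mem_L ha.1 (C.α_mem ha.1 ha' hb.1 hab)
            (C.lt_α ha.1 ha' hb.1 hab)
          lt_α := fun ha ha' hb => C.lt_α ha.1 ha' hb.1
          α_le := fun ha ha' hb => C.α_le ha.1 ha' hb.1
          β_mem := fun ha ha' hb hab => mem_L ha.1 (C.β_mem ha.1 ha' hb.1 hab)
            ((C.lt_α ha.1 ha' hb.1 hab).trans_le (C.α_le_β ha.1 ha' hb.1 hab))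
          α_le_β := fun ha ha' hb => C.α_le_β ha.1 ha' hb.1
          γ_mem := fun ha ha' => mem_L ha.1 (C.γ_mem ha.1 ha') (C.lt_γ ha.1 ha')
          lt_γ := fun ha => C.lt_γ ha.1
          γ_le_β := fun ha ha' hb => C.γ_le_β ha.1 ha' hb.1 }
  have h3 := h2.trans h1
  rwa [← map_comp] at h3

/-- An invariant subposet onto which there is an equivariant retraction `r ≤ id`. -/
theorem isEquivariantHomotopyEquiv_of_retraction {D S : SubMulAction H P} (hDS : D ≤ S)
    (r : S →o D) (hr : ∀ (h : H) a, r (h • a) = h • r a)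
    (hrD : ∀ a : D, r (SubMulAction.inclusionHom hDS a) = a) (hrS : ∀ a : S, (r a : P) ≤ a) :
    IsEquivariantHomotopyEquiv H (PosetRealization.map (SubMulAction.inclusionHom hDS)) := by
  have hle : ∀ a, (SubMulAction.inclusionHom hDS).comp r a ≤ OrderHom.id a := hrS
  have h1 : (map r).comp (map (SubMulAction.inclusionHom hDS)) = ContinuousMap.id _ := by
    rw [← map_comp, show r.comp (SubMulAction.inclusionHom hDS) = OrderHom.id from
      OrderHom.ext _ _ (funext hrD)]
    exact ContinuousMap.ext map_id
  have h2 : (ContinuousMap.id (PosetRealization S)) = map OrderHom.id :=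
    (ContinuousMap.ext map_id).symm
  refine ⟨fun h x => PosetRealization.map_smul (fun _ _ => rfl) h x, map r, fun h x => PosetRealization.map_smul hr h x, ?_, ?_⟩
  · rw [h1]
    exact ⟨ContinuousMap.Homotopy.refl _, fun _ _ _ => rfl⟩
  · rw [h2, ← map_comp]
    exact ⟨slide _ _ hle, fun h t x => slide_smul hle
      (fun h a => by
        change SubMulAction.inclusionHom hDS (r (h • a)) = h • SubMulAction.inclusionHom hDS (r a)
        rw [hr]; rfl) (fun _ _ => rfl) h t x⟩

end Removal

/-! ### Distinguished subgroups of groups of parabolic characteristic `p` -/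

section Groups

variable {p : ℕ} {G : Type*} [Group G]

theorem Subgroup.exists_mul_of_mem_sup {R Q : Subgroup G} (h : Q ≤ normalizer (R : Set G)) {x : G}
    (hx : x ∈ R ⊔ Q) : ∃ r ∈ R, ∃ q ∈ Q, x = r * q := by
  rw [sup_eq_closure] at hx
  rw [le_normalizer_iff] at h
  induction hx using closure_induction with
  | mem x hx =>
    rcases hx with hx | hx
    · exact ⟨x, hx, 1, one_mem _, by simp⟩
    · exact ⟨1, one_mem _, x, hx, by simp⟩
  | one => exact ⟨1, one_mem _, 1, one_mem _, by simp⟩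
  | mul x y _ _ hx hy =>
    obtain ⟨r, hr, q, hq, rfl⟩ := hx
    obtain ⟨r', hr', q', hq', rfl⟩ := hy
    exact ⟨r * (q * r' * q⁻¹), mul_mem hr (h q hq r' hr'), q * q', mul_mem hq hq', by group⟩
  | inv x _ hx =>
    obtain ⟨r, hr, q, hq, rfl⟩ := hx
    refine ⟨q⁻¹ * r⁻¹ * q⁻¹⁻¹, h _ (inv_mem hq) _ (inv_mem hr), q⁻¹, inv_mem hq, by group⟩

theorem Subgroup.normalizer_le_normalizer_centralizer (K : Subgroup G) :
    normalizer (K : Set G) ≤ normalizer (centralizer (K : Set G) : Set G) := by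
  refine le_normalizer_iff.2 fun g hg x hx => mem_centralizer_iff.2 fun c hc => ?_
  have h := mem_centralizer_iff.1 hx _ ((mem_normalizer_iff''.1 hg c).1 hc)
  calc c * (g * x * g⁻¹) = g * (g⁻¹ * c * g * x) * g⁻¹ := by group
    _ = g * (x * (g⁻¹ * c * g)) * g⁻¹ := by rw [h]
    _ = g * x * g⁻¹ * c := by group

theorem IsPGroup.eq_one_of_coprime {U : Subgroup G} (hU : IsPGroup p U) {x : G} (hx : x ∈ U)
    (hc : (orderOf x).Coprime p) : x = 1 := by
  obtain ⟨k, hk⟩ := hU ⟨x, hx⟩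
  have hk' : x ^ p ^ k = 1 := congrArg Subtype.val hk
  rw [← orderOf_eq_one_iff]
  exact (hc.pow_right k).eq_one_of_dvd (orderOf_dvd_of_pow_eq_one hk')

/-! ### The `p`-core of a subgroup -/

theorem isPGroup_opCore : IsPGroup p (opCore p G) :=
  Sylow.sSup_of_normal _ (fun _ h => h.2) fun _ h => h.1

/-- `O_p(N)` as a subgroup of `G`, for `N ≤ G`. -/
def subgroupCore (p : ℕ) (N : Subgroup G) : Subgroup G := (opCore p N).map N.subtype

theorem subgroupCore_le (N : Subgroup G) : subgroupCore p N ≤ N := Subgroup.map_subtype_le _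

theorem isPGroup_subgroupCore (N : Subgroup G) : IsPGroup p (subgroupCore p N) :=
  isPGroup_opCore.map _

theorem le_normalizer_subgroupCore (N : Subgroup G) :
    N ≤ Subgroup.normalizer (subgroupCore p N : Set G) := by
  have : (opCore p N).Normal := Subgroup.sSup_normal _ fun _ h => h.1
  rw [← Subgroup.normal_subgroupOf_iff_le_normalizer (subgroupCore_le N)]
  have e : (subgroupCore p N).subgroupOf N = opCore p N :=
    Subgroup.comap_map_eq_self_of_injective N.subtype_injective _
  rwa [e]

theorem le_subgroupCore {U N : Subgroup G} (hU : IsPGroup p U) (hUN : U ≤ N)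
    (hNU : N ≤ Subgroup.normalizer (U : Set G)) : U ≤ subgroupCore p N := by
  rw [← Subgroup.map_subgroupOf_eq_of_le hUN]
  exact Subgroup.map_mono (le_sSup ⟨(Subgroup.normal_subgroupOf_iff_le_normalizer hUN).2 hNU,
    hU.comap_subtype⟩)

theorem map_subgroupCore (N : Subgroup G) (φ : G ≃* G) :
    (subgroupCore p N).map φ.toMonoidHom = subgroupCore p (N.map φ.toMonoidHom) := by
  have key : ∀ (N : Subgroup G) (φ : G ≃* G),
      (subgroupCore p N).map φ.toMonoidHom ≤ subgroupCore p (N.map φ.toMonoidHom) := fun N φ => by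
    refine le_subgroupCore ((isPGroup_subgroupCore N).map _)
      (Subgroup.map_mono (subgroupCore_le N)) ?_
    rw [← Subgroup.map_equiv_normalizer_eq]
    exact Subgroup.map_mono (le_normalizer_subgroupCore N)
  have inv : ∀ (K : Subgroup G) (φ : G ≃* G),
      (K.map φ.symm.toMonoidHom).map φ.toMonoidHom = K := fun K φ => by
    rw [Subgroup.map_map]
    convert! K.map_id
    ext x
    simp
  refine le_antisymm (key N φ) ?_
  have h := Subgroup.map_mono (f := φ.toMonoidHom) (key (N.map φ.toMonoidHom) φ.symm)
  rwa [inv, show (N.map φ.toMonoidHom).map φ.symm.toMonoidHom = N from inv N φ.symm] at h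

/-! ### Actions on `p`-groups -/

/-- Normalizers grow in a finite `p`-group because it is nilpotent. -/
theorem IsPGroup.exists_mem_normalizer_of_lt [Finite G] [Fact p.Prime]
    {U V : Subgroup G} (hU : IsPGroup p U) (h : V < U) :
    ∃ y ∈ U, y ∉ V ∧ y ∈ Subgroup.normalizer (V : Set G) := by
  have := hU.isNilpotent
  have hlt : V.subgroupOf U < ⊤ := by
    rw [lt_top_iff_ne_top, Ne, Subgroup.subgroupOf_eq_top]
    exact h.not_ge
  obtain ⟨y, hy, hyV⟩ := SetLike.exists_of_lt
    (Group.normalizerCondition_of_isNilpotent (V.subgroupOf U) hlt)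
  refine ⟨y, y.2, fun hy' => hyV hy', Subgroup.mem_normalizer_iff.2 fun x => ⟨fun hx => ?_,
    fun hx => ?_⟩⟩
  · exact (Subgroup.mem_normalizer_iff.1 hy ⟨x, h.le hx⟩).1 hx
  · have hxU : x ∈ U := by
      have := mul_mem (mul_mem (inv_mem y.2) (h.le hx)) y.2
      simpa [mul_assoc] using this
    exact (Subgroup.mem_normalizer_iff.1 hy ⟨x, hxU⟩).2 hx

theorem IsPGroup.lt_inf_normalizer [Finite G] [Fact p.Prime]
    {U V : Subgroup G} (hU : IsPGroup p U) (h : V < U) :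
    V < U ⊓ Subgroup.normalizer (V : Set G) := by
  obtain ⟨y, hyU, hyV, hy⟩ := hU.exists_mem_normalizer_of_lt h
  exact SetLike.lt_iff_le_and_exists.2 ⟨le_inf h.le Subgroup.le_normalizer, y,
    Subgroup.mem_inf.2 ⟨hyU, hy⟩, hyV⟩

/-- Thompson's `A × B` lemma: if a `p'`-element `x` commutes with a `p`-group `Q`, both act on a
`p`-group `R`, and `x` centralizes `C_R(Q)`, then `x` centralizes `R`. -/
theorem IsPGroup.commute_of_commute_centralizer [Finite G] [Fact p.Prime]
    {x : G} (hx : (orderOf x).Coprime p)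
    {Q R : Subgroup G} (hQ : IsPGroup p Q) (hR : IsPGroup p R)
    (hQR : Q ≤ Subgroup.normalizer (R : Set G)) (hxR : x ∈ Subgroup.normalizer (R : Set G))
    (hxQ : ∀ b ∈ Q, Commute x b) (hfix : ∀ r ∈ R, (∀ b ∈ Q, Commute r b) → Commute x r) :
    ∀ r ∈ R, Commute x r := by
  by_contra! ⟨r₀, hr₀, hxr₀⟩
  have hU : IsPGroup p (R ⊔ Q : Subgroup G) := hR.to_sup_of_normal_left' hQ hQR
  -- Let `V = C_{RQ}(x)`, which contains `Q`. If `V` is proper, its normalizer in `RQ` has an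
  -- element `r q` outside `V`; then `r` normalizes `V` too, and the aim is the contradiction `r ∈
  -- V`.
  have mem_V : ∀ {v}, v ∈ (R ⊔ Q) ⊓ Subgroup.centralizer {x} ↔ v ∈ R ⊔ Q ∧ Commute x v :=
    fun {v} => by
      rw [Subgroup.mem_inf, Subgroup.mem_centralizer_iff]
      simp [Commute, SemiconjBy]
  have hlt : (R ⊔ Q) ⊓ Subgroup.centralizer {x} < R ⊔ Q :=
    lt_of_le_of_ne inf_le_left fun e => by
      have h : r₀ ∈ R ⊔ Q := Subgroup.mem_sup_left hr₀
      rw [← e] at h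
      exact hxr₀ (mem_V.1 h).2
  obtain ⟨y, hyU, hyV, hy⟩ := hU.exists_mem_normalizer_of_lt hlt
  have Q_V : ∀ b ∈ Q, b ∈ (R ⊔ Q) ⊓ Subgroup.centralizer {x} := fun b hb =>
    mem_V.2 ⟨Subgroup.mem_sup_right hb, hxQ b hb⟩
  obtain ⟨r, hr, q, hq, rfl⟩ := Subgroup.exists_mul_of_mem_sup hQR hyU
  have hrN : r ∈ Subgroup.normalizer
      (((R ⊔ Q) ⊓ Subgroup.centralizer {x} : Subgroup G) : Set G) := by
    simpa using mul_mem hy (inv_mem (Subgroup.le_normalizer (Q_V q hq)))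
  refine hyV (mul_mem (mem_V.2 ⟨Subgroup.mem_sup_left hr, ?_⟩) (Q_V q hq))
  -- the commutator `w` of `r` and `x` lies in `C_R(Q)`
  have hwR : r * x * r⁻¹ * x⁻¹ ∈ R := by
    have := mul_mem hr ((Subgroup.mem_normalizer_iff.1 hxR r⁻¹).1 (inv_mem hr))
    simpa [mul_assoc] using this
  have hwQ : ∀ b ∈ Q, Commute (r * x * r⁻¹ * x⁻¹) b := by
    intro b hb
    -- Both `b` and its conjugate by `r` lie in `V`, so this commutator commutes with `x`;
    -- rearranged, `b` commutes with `r * x * r⁻¹ * x⁻¹`.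
    have hc : r⁻¹ * b * r * b⁻¹ ∈ (R ⊔ Q) ⊓ Subgroup.centralizer {x} :=
      mul_mem ((Subgroup.mem_normalizer_iff''.1 hrN b).1 (Q_V b hb)) (inv_mem (Q_V b hb))
    have hcx := (mem_V.1 hc).2.eq
    have hbx := (hxQ b hb).eq
    have h1 : b * r = r * (r⁻¹ * b * r * b⁻¹) * b := by group
    have h2 : b * (r * x * r⁻¹ * x⁻¹) * b⁻¹ = r * x * r⁻¹ * x⁻¹ := by
      calc b * (r * x * r⁻¹ * x⁻¹) * b⁻¹
          = b * r * x * r⁻¹ * x⁻¹ * b⁻¹ := by group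
        _ = r * ((r⁻¹ * b * r * b⁻¹) * (b * x)) * r⁻¹ * x⁻¹ * b⁻¹ := by rw [h1]; group
        _ = r * ((r⁻¹ * b * r * b⁻¹) * x) * b * r⁻¹ * x⁻¹ * b⁻¹ := by rw [← hbx]; group
        _ = r * x * r⁻¹ * b * (b * x)⁻¹ := by rw [← hcx]; group
        _ = r * x * r⁻¹ * x⁻¹ := by rw [← hbx]; group
    exact (mul_inv_eq_iff_eq_mul.1 h2).symm
  have hxw : Commute x (r * x * r⁻¹ * x⁻¹) := hfix _ hwR hwQ
  -- The commutator times `x` is a conjugate of `x`. Since the two factors commute, the order of the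
  -- commutator divides that of `x`, while it also lies in the `p`-group `R`.
  have hw : r * x * r⁻¹ * x⁻¹ = 1 := by
    refine hR.eq_one_of_coprime hwR (Nat.Coprime.coprime_dvd_left ?_ hx)
    refine orderOf_dvd_of_pow_eq_one ?_
    have h1 : (r * x * r⁻¹ * x⁻¹ * x) ^ orderOf x = 1 := by
      rw [inv_mul_cancel_right, conj_pow, pow_orderOf_eq_one]
      simp
    rwa [hxw.symm.mul_pow, pow_orderOf_eq_one, mul_one] at h1
  have h3 : r * x = x * r := by
    have := mul_inv_eq_one.1 hw
    exact mul_inv_eq_iff_eq_mul.1 this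
  exact h3.symm

/-! ### Distinguished subgroups -/

theorem mem_distinguishedSubgroups_iff [Fact p.Prime] {P : Subgroup G} :
    P ∈ distinguishedSubgroups p G ↔ IsPGroup p P ∧ ∃ z, IsPCentral p z ∧ z ∈ centerIn P := by
  have ne_one : ∀ {z : G}, IsPCentral p z → z ≠ 1 := fun hz e =>
    (Fact.out : p.Prime).one_lt.ne (by rw [← hz.1, e, orderOf_one])
  constructor
  · rintro ⟨⟨h1, -⟩, h2⟩
    refine ⟨h1, ?_⟩
    by_contra! h
    refine h2 ((Subgroup.closure_eq_bot_iff).2 fun x hx => absurd hx.1.1 (h x hx.2))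
  · rintro ⟨h1, z, hz, hzP⟩
    refine ⟨⟨h1, ?_⟩, ?_⟩
    · rintro rfl
      exact ne_one hz (Subgroup.mem_bot.1 (mem_centerIn.1 hzP).1)
    · intro e
      refine ne_one hz (Subgroup.mem_bot.1 (e ▸ Subgroup.subset_closure ⟨⟨hzP, ?_⟩, hz⟩))
      rw [← hz.1, pow_orderOf_eq_one]

/-- From `Z(P) ≤ A ≤ P` follows `Z(P) ≤ Z(A)`, so the same `p`-central element serves. This covers
both `C_Q(T)` and `N_R(Q)`. -/
theorem mem_distinguishedSubgroups_of_centerIn_le [Fact p.Prime] {A P : Subgroup G}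
    (hP : P ∈ distinguishedSubgroups p G) (hAP : A ≤ P) (h : centerIn P ≤ A) :
    A ∈ distinguishedSubgroups p G := by
  rw [mem_distinguishedSubgroups_iff] at hP ⊢
  obtain ⟨h1, z, hz, hzP⟩ := hP
  exact ⟨h1.to_le hAP, z, hz, mem_centerIn.2
    ⟨h hzP, fun y hy => (mem_centerIn.1 hzP).2 y (hAP hy)⟩⟩

theorem inf_normalizer_mem_distinguishedSubgroups [Fact p.Prime] {Q R : Subgroup G}
    (hR : R ∈ distinguishedSubgroups p G) (hQR : Q ≤ R) :
    R ⊓ Subgroup.normalizer (Q : Set G) ∈ distinguishedSubgroups p G :=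
  mem_distinguishedSubgroups_of_centerIn_le hR inf_le_left fun _ hz =>
    have hz := mem_centerIn.1 hz
    Subgroup.mem_inf.2 ⟨hz.1, Subgroup.centralizer_le_normalizer _
      (Subgroup.mem_centralizer_iff.2 fun y hy => hz.2 y (hQR hy))⟩

/-- The Sylow subgroup with `z` in its center normalizes `⟨z⟩`, so parabolic characteristic `p`
applies directly to `N_G(⟨z⟩)`. -/
theorem mem_subgroupCore_normalizer_of_isPCentral [Fact p.Prime]
    (hG : HasParabolicCharacteristic p G) {z : G}
    (hz : IsPCentral p z) {x : G} (hx : x ∈ Subgroup.normalizer (Subgroup.zpowers z : Set G))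
    (hc : ∀ u ∈ subgroupCore p (Subgroup.normalizer (Subgroup.zpowers z : Set G)), Commute u x) :
    x ∈ subgroupCore p (Subgroup.normalizer (Subgroup.zpowers z : Set G)) := by
  have hne : z ≠ 1 := fun e =>
    (Fact.out : p.Prime).one_lt.ne (by rw [← hz.1, e, orderOf_one])
  obtain ⟨ho, S, hS⟩ := hz
  have hchar := hG (Subgroup.normalizer (Subgroup.zpowers z : Set G))
    ⟨_, IsPGroup.of_card (n := 1) (by rw [Nat.card_zpowers, ho, pow_one]),
      by rwa [Ne, Subgroup.zpowers_eq_bot], rfl⟩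
    ⟨S, fun s hs => Subgroup.centralizer_le_normalizer _ (Subgroup.mem_centralizer_iff.2 ?_)⟩
  · refine Subgroup.mem_map.2 ⟨⟨x, hx⟩, hchar (Subgroup.mem_centralizer_iff.2 fun u hu => ?_), rfl⟩
    exact Subtype.ext (hc u (Subgroup.mem_map_of_mem _ hu))
  · rintro _ ⟨k, rfl⟩
    have : Commute z s := ((mem_centerIn.1 hS).2 s hs).symm
    exact (this.zpow_left k).eq

/-- The normalizer of a distinguished subgroup has characteristic `p`. -/
theorem centralizer_subgroupCore_le [Finite G] [Fact p.Prime]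
    (hG : HasParabolicCharacteristic p G) {Q : Subgroup G}
    (hQ : Q ∈ distinguishedSubgroups p G) :
    Subgroup.centralizer (subgroupCore p (Subgroup.normalizer (Q : Set G)) : Set G) ≤
      subgroupCore p (Subgroup.normalizer (Q : Set G)) := by
  obtain ⟨hQp, z, hz, hzQ⟩ := mem_distinguishedSubgroups_iff.1 hQ
  rw [mem_centerIn] at hzQ
  set N := Subgroup.normalizer (Q : Set G)
  have hQN : Q ≤ subgroupCore p N := le_subgroupCore hQp Subgroup.le_normalizer le_rfl
  have hCQ : Subgroup.centralizer (subgroupCore p N : Set G) ≤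
      Subgroup.centralizer (Q : Set G) := Subgroup.centralizer_le hQN
  -- The centralizer is normalized by `N` and contained in it, so it only remains to show that it is
  -- a `p`-group.
  refine le_subgroupCore ?_ (hCQ.trans (Subgroup.centralizer_le_normalizer _))
    ((le_normalizer_subgroupCore N).trans (Subgroup.normalizer_le_normalizer_centralizer _))
  set Z := Subgroup.normalizer (Subgroup.zpowers z : Set G)
  have hCz : ∀ g : G, Commute z g → g ∈ Z := fun g hg =>
    Subgroup.centralizer_le_normalizer _ (Subgroup.mem_centralizer_iff.2 (by
      rintro _ ⟨k, rfl⟩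
      exact (hg.zpow_left k).eq))
  have hQZ : Q ≤ Z := fun q hq => hCz q (hzQ.2 q hq).symm
  have hCZ : Subgroup.centralizer (Q : Set G) ≤ Z := fun g hg =>
    hCz g (Subgroup.mem_centralizer_iff.1 hg z hzQ.1)
  -- `O_p(C_G(Q))` is characteristic in `C_G(Q)`, which `N` normalizes.
  have hCore : subgroupCore p (Subgroup.centralizer (Q : Set G)) ≤ subgroupCore p N := by
    refine le_subgroupCore (isPGroup_subgroupCore _)
      ((subgroupCore_le _).trans (Subgroup.centralizer_le_normalizer _)) fun g hg => ?_
    rw [Subgroup.mem_normalizer_iff_map_conj_eq]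
    refine (map_subgroupCore _ (MulAut.conj g)).trans (congrArg _ ?_)
    exact Subgroup.mem_normalizer_iff_map_conj_eq.1
      (Subgroup.normalizer_le_normalizer_centralizer Q hg)
  intro y
  obtain ⟨y, hy⟩ := y
  -- Raising to the `p`-part of the order of `y` leaves a `p'`-element, which is then shown to be
  -- trivial.
  set k := (orderOf y).factorization p
  refine ⟨k, Subtype.ext ?_⟩
  change y ^ p ^ k = 1
  have hx : y ^ p ^ k ∈ Subgroup.centralizer (subgroupCore p N : Set G) := pow_mem hy _
  have hcop : (orderOf (y ^ p ^ k)).Coprime p := by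
    rw [orderOf_pow_of_dvd (pow_ne_zero _ (Fact.out : p.Prime).ne_zero) (Nat.ordProj_dvd _ _)]
    exact (Nat.coprime_ordCompl Fact.out (orderOf_pos y).ne').symm
  generalize y ^ p ^ k = x at hx hcop
  have hxQ : ∀ b ∈ Q, Commute x b := fun b hb =>
    ((Subgroup.mem_centralizer_iff.1 (hCQ hx)) b hb).symm
  -- The `A × B` lemma for `Q` and `x` acting on `O_p(Z)`. Its hypothesis holds because
  -- `C_{O_p(Z)}(Q)` is a normal `p`-subgroup of `C_G(Q)`, hence lies in `O_p(N)`, which `x`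
  -- centralizes.
  have hR : ∀ r ∈ subgroupCore p Z, Commute x r := by
    refine IsPGroup.commute_of_commute_centralizer hcop hQp (isPGroup_subgroupCore Z)
      (hQZ.trans (le_normalizer_subgroupCore Z)) (le_normalizer_subgroupCore Z (hCZ (hCQ hx))) hxQ
      fun r hr hrQ => ?_
    have hrC : r ∈ subgroupCore p Z ⊓ Subgroup.centralizer (Q : Set G) :=
      Subgroup.mem_inf.2 ⟨hr, Subgroup.mem_centralizer_iff.2 fun b hb => (hrQ b hb).symm⟩
    refine ((Subgroup.mem_centralizer_iff.1 hx) r (hCore (le_subgroupCore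
      ((isPGroup_subgroupCore Z).to_le inf_le_left) inf_le_right ?_ hrC))).symm
    exact (le_inf (hCZ.trans (le_normalizer_subgroupCore Z)) Subgroup.le_normalizer).trans
      Subgroup.inf_normalizer_le_normalizer_inf
  exact (isPGroup_subgroupCore Z).eq_one_of_coprime
    (mem_subgroupCore_normalizer_of_isPCentral hG hz (hCZ (hCQ hx)) fun u hu => (hR u hu).symm) hcop

/-- A `p`-subgroup containing `O_p(N_G(Q))`, for a distinguished `Q`, is distinguished. -/
theorem mem_distinguishedSubgroups_of_subgroupCore_le [Finite G] [Fact p.Prime]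
    (hG : HasParabolicCharacteristic p G)
    {Q U : Subgroup G} (hQ : Q ∈ distinguishedSubgroups p G) (hU : IsPGroup p U)
    (h : subgroupCore p (Subgroup.normalizer (Q : Set G)) ≤ U) :
    U ∈ distinguishedSubgroups p G := by
  have hQU : Q ≤ U := (le_subgroupCore hQ.1.1 Subgroup.le_normalizer le_rfl).trans h
  obtain ⟨S, hUS⟩ := hU.exists_le_sylow
  have hne : Nontrivial (S : Subgroup G) := by
    rw [Subgroup.nontrivial_iff_ne_bot]
    exact fun e => hQ.1.2 (le_bot_iff.1 (e ▸ hQU.trans hUS))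
  have hcen : Nontrivial (Subgroup.center (S : Subgroup G)) := S.2.center_nontrivial
  have hdvd : p ∣ Nat.card (Subgroup.center (S : Subgroup G)) :=
    (S.2.to_subgroup _).card_eq_or_dvd.resolve_left Finite.one_lt_card.ne'
  obtain ⟨z, hz⟩ := exists_prime_orderOf_dvd_card' p hdvd
  have hzS : ((z : (S : Subgroup G)) : G) ∈ centerIn (S : Subgroup G) :=
    Subgroup.mem_map_of_mem _ z.2
  have hzU : ∀ y ∈ U, y * (z : (S : Subgroup G)) = (z : (S : Subgroup G)) * y := fun y hy =>
    (mem_centerIn.1 hzS).2 y (hUS hy)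
  refine mem_distinguishedSubgroups_iff.2 ⟨hU, _, ⟨?_, S, hzS⟩, mem_centerIn.2 ⟨?_, hzU⟩⟩
  · rw [Subgroup.orderOf_coe, Subgroup.orderOf_coe, hz]
  -- Being central in `S`, the element `z` centralizes `O_p(N_G(Q)) ≤ U ≤ S`, so it lies in
  -- `O_p(N_G(Q))`.
  · exact h (centralizer_subgroupCore_le hG hQ
      (Subgroup.mem_centralizer_iff.2 fun u hu => hzU u (h hu)))

/-- A `p`-central element of `T` would generate `T`, which has order `p`, and so put the given
generator into the center of a Sylow subgroup. -/
theorem notMem_distinguishedSubgroups_of_isNoncentralOfOrder [Finite G] [Fact p.Prime]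
    {T : Subgroup G}
    (hT : IsNoncentralOfOrder p T) : T ∉ distinguishedSubgroups p G := by
  rw [mem_distinguishedSubgroups_iff]
  rintro ⟨-, z, ⟨ho, S, hS⟩, hzT⟩
  obtain ⟨x, hx, hxS, rfl⟩ := hT
  have hzx := (mem_centerIn.1 hzT).1
  have hle : Subgroup.zpowers z = Subgroup.zpowers x :=
    Subgroup.eq_of_le_of_card_ge ((Subgroup.zpowers_le).2 hzx)
      (by rw [Nat.card_zpowers, Nat.card_zpowers, ho, hx])
  have hxz : x ∈ Subgroup.zpowers z := hle ▸ Subgroup.mem_zpowers x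
  exact hxS S x ((Subgroup.zpowers_le).2 hS hxz) (IsConj.refl x)

theorem IsNoncentralOfOrder.isPGroup {T : Subgroup G} (hT : IsNoncentralOfOrder p T) :
    IsPGroup p T := by
  obtain ⟨x, hx, -, rfl⟩ := hT
  exact IsPGroup.of_card (n := 1) (by rw [Nat.card_zpowers, hx, pow_one])

theorem IsNoncentralOfOrder.le_centralizer {T : Subgroup G} (hT : IsNoncentralOfOrder p T) :
    T ≤ Subgroup.centralizer (T : Set G) := by
  obtain ⟨x, -, -, rfl⟩ := hT
  exact Subgroup.le_centralizer _

/-! ### The homotopy equivalence -/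

instance conjSubgroupCovariant (H : Subgroup G) :
    CovariantClass H (Subgroup G) (· • ·) (· ≤ ·) where
  elim h _ _ hPQ := conj_smul_mono H h hPQ

theorem conj_smul_sup (H : Subgroup G) (h : H) (P Q : Subgroup G) :
    h • (P ⊔ Q) = h • P ⊔ h • Q := Subgroup.map_sup _ _ _

theorem conj_smul_inf (H : Subgroup G) (h : H) (P Q : Subgroup G) :
    h • (P ⊓ Q) = h • P ⊓ h • Q := Subgroup.map_inf _ _ _ (MulAut.conj (h : G)).injective

theorem conj_smul_normalizer (H : Subgroup G) (h : H) (Q : Subgroup G) :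
    h • Subgroup.normalizer (Q : Set G) = Subgroup.normalizer ((h • Q : Subgroup G) : Set G) :=
  Subgroup.map_equiv_normalizer_eq Q (MulAut.conj (h : G))

theorem conj_smul_subgroupCore (H : Subgroup G) (h : H) (N : Subgroup G) :
    h • subgroupCore p N = subgroupCore p (h • N) := map_subgroupCore N (MulAut.conj (h : G))

theorem conj_smul_centralizer (T : Subgroup G) (h : Subgroup.normalizer (T : Set G)) :
    h • Subgroup.centralizer (T : Set G) = Subgroup.centralizer (T : Set G) :=
  Subgroup.mem_normalizer_iff_map_conj_eq.1
    (Subgroup.normalizer_le_normalizer_centralizer T h.2)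

/-- The distinguished `p`-subgroups containing `T`. -/
def distinguishedContaining (p : ℕ) (T : Subgroup G) :
    SubMulAction (Subgroup.normalizer (T : Set G)) (Subgroup G) where
  carrier := {Q | Q ∈ distinguishedSubgroups p G ∧ T ≤ Q}
  smul_mem' h Q hQ := ⟨conj_smul_mem_distinguished _ h hQ.1, by
    have := conj_smul_mono _ h hQ.2
    rwa [conj_smul_eq_self] at this⟩

theorem distinguishedContaining_le_fixed (T : Subgroup G) :
    distinguishedContaining p T ≤ distinguishedFixed p T :=
  fun _ hQ => ⟨hQ.1, hQ.2.trans Subgroup.le_normalizer⟩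

theorem distinguishedAbove_le_containing (T : Subgroup G) :
    distinguishedAbove p T ≤ distinguishedContaining p T :=
  fun _ hP => ⟨hP.1, hP.2.1.le⟩

/-- `Q ↦ C_Q(T)` retracts the distinguished subgroups containing `T` onto those contained in
`C_G(T)`. -/
theorem isEquivariantHomotopyEquiv_above_containing [Finite G] [Fact p.Prime] {T : Subgroup G}
    (hT : IsNoncentralOfOrder p T) :
    IsEquivariantHomotopyEquiv (Subgroup.normalizer (T : Set G)) (PosetRealization.map
      (SubMulAction.inclusionHom (distinguishedAbove_le_containing (p := p) T))) := by
  have mem : ∀ Q ∈ distinguishedContaining p T,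
      Q ⊓ Subgroup.centralizer (T : Set G) ∈ distinguishedAbove p T := by
    rintro Q ⟨hQ, hTQ⟩
    have hd : Q ⊓ Subgroup.centralizer (T : Set G) ∈ distinguishedSubgroups p G :=
      mem_distinguishedSubgroups_of_centerIn_le hQ inf_le_left fun z hz =>
        have hz := mem_centerIn.1 hz
        Subgroup.mem_inf.2 ⟨hz.1, Subgroup.mem_centralizer_iff.2 fun y hy => hz.2 y (hTQ hy)⟩
    refine ⟨hd, lt_of_le_of_ne (le_inf hTQ hT.le_centralizer) fun e => ?_, inf_le_right⟩
    exact notMem_distinguishedSubgroups_of_isNoncentralOfOrder hT (e ▸ hd)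
  refine isEquivariantHomotopyEquiv_of_retraction _
    ⟨fun Q => ⟨Q.1 ⊓ Subgroup.centralizer (T : Set G), mem Q.1 Q.2⟩,
      fun Q Q' h => (inf_le_inf_right _ h : Q.1 ⊓ _ ≤ Q'.1 ⊓ _)⟩ (fun h Q => Subtype.ext ?_)
    (fun P => Subtype.ext (inf_eq_left.2 P.2.2.2)) fun Q => inf_le_left
  change h • Q.1 ⊓ Subgroup.centralizer (T : Set G) =
    h • (Q.1 ⊓ Subgroup.centralizer (T : Set G))
  rw [conj_smul_inf, conj_smul_centralizer]

/-- For `Q` normalized by `T` with `T ≰ Q`, the distinguished subgroups `R > Q` normalized by `T`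
contract through `R ≥ N_R(Q) ≤ N_R(Q) T O_p(N_G(Q)) ≥ T O_p(N_G(Q))`. -/
theorem isLinkContraction_distinguishedFixed [Finite G] [Fact p.Prime]
    (hG : HasParabolicCharacteristic p G)
    {T : Subgroup G} (hT : IsPGroup p T) :
    IsLinkContraction (distinguishedFixed p T) (distinguishedContaining p T)
      (fun Q R => R ⊓ Subgroup.normalizer (Q : Set G))
      (fun Q R => R ⊓ Subgroup.normalizer (Q : Set G) ⊔ T ⊔
        subgroupCore p (Subgroup.normalizer (Q : Set G)))
      (fun Q => T ⊔ subgroupCore p (Subgroup.normalizer (Q : Set G))) := by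
  have hTN : ∀ {Q R : Subgroup G}, T ≤ Subgroup.normalizer (Q : Set G) →
      T ≤ Subgroup.normalizer (R : Set G) →
      T ≤ Subgroup.normalizer ((R ⊓ Subgroup.normalizer (Q : Set G) : Subgroup G) : Set G) :=
    fun hQ hR => (le_inf hR (hQ.trans Subgroup.le_normalizer)).trans
      Subgroup.inf_normalizer_le_normalizer_inf
  -- Adjoining `O_p(N_G(Q))` to a `p`-subgroup of `N_G(Q)` gives a `p`-group, which is distinguished
  -- because it contains `O_p(N_G(Q))`; it is `T`-invariant because it contains `T`.
  have mem : ∀ {Q V : Subgroup G}, Q ∈ distinguishedFixed p T → IsPGroup p V →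
      V ≤ Subgroup.normalizer (Q : Set G) → T ≤ V →
      V ⊔ subgroupCore p (Subgroup.normalizer (Q : Set G)) ∈ distinguishedFixed p T :=
    fun hQ hV hVN hTV =>
      ⟨mem_distinguishedSubgroups_of_subgroupCore_le hG hQ.1
        (hV.to_sup_of_normal_right' (isPGroup_subgroupCore _)
          (hVN.trans (le_normalizer_subgroupCore _))) le_sup_right,
        (hTV.trans le_sup_left).trans Subgroup.le_normalizer⟩
  exact
    { α_mem := fun hQ _ hR hQR =>
        ⟨inf_normalizer_mem_distinguishedSubgroups hR.1 hQR.le, hTN hQ.2 hR.2⟩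
      lt_α := fun _ _ hR hQR => hR.1.1.1.lt_inf_normalizer hQR
      α_le := fun _ _ _ _ => inf_le_left
      α_mono := fun h => inf_le_inf_right _ h
      α_smul := fun h Q R => by rw [conj_smul_inf, conj_smul_normalizer]
      β_mem := fun hQ _ hR _ => mem hQ
        ((hR.1.1.1.to_inf_left).to_sup_of_normal_left' hT (hTN hQ.2 hR.2))
        (sup_le inf_le_right hQ.2) le_sup_right
      α_le_β := fun _ _ _ _ => le_sup_left.trans le_sup_left
      β_mono := fun h => sup_le_sup_right (sup_le_sup_right (inf_le_inf_right _ h) _) _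
      β_smul := fun h Q R => by
        rw [conj_smul_sup, conj_smul_sup, conj_smul_inf, conj_smul_subgroupCore,
          conj_smul_normalizer, conj_smul_eq_self]
      γ_mem := fun hQ _ => mem hQ hT hQ.2 le_rfl
      -- Strictness comes from `T ≰ Q`; `O_p(N_G(Q))` alone may equal `Q`.
      lt_γ := fun {Q} hQ hQ' => lt_of_le_of_ne
        ((le_subgroupCore hQ.1.1.1 Subgroup.le_normalizer le_rfl).trans le_sup_right)
        fun e => hQ' ⟨hQ.1, le_sup_left.trans e.ge⟩
      γ_le_β := fun _ _ _ _ => sup_le_sup_right le_sup_right _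
      γ_smul := fun h Q => by
        rw [conj_smul_sup, conj_smul_subgroupCore, conj_smul_normalizer, conj_smul_eq_self] }

end Groups

theorem proposition4p4 {G : Type*} [Group G] [Finite G] (p : ℕ) [Fact p.Prime]
    (hG : HasParabolicCharacteristic p G) (T : Subgroup G) (hT : IsNoncentralOfOrder p T) :
    IsEquivariantHomotopyEquiv (Subgroup.normalizer (T : Set G))
      (PosetRealization.map (distinguishedInclusion p T)) := by
  have h := (isEquivariantHomotopyEquiv_above_containing hT).trans
    (isEquivariantHomotopyEquiv_of_isLinkContraction (distinguishedContaining_le_fixed T)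
      (fun _ hP _ hQ hPQ => ⟨hQ.1, hP.2.trans hPQ⟩)
      (isLinkContraction_distinguishedFixed hG hT.isPGroup))
  rwa [← PosetRealization.map_comp] at h
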